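/- There are absolute constants $K, C > 0$ such that the following holds. Let $P$ be a probability distribution on $\mathbb{R}^d$ with finite second moment, mean $\mu$ and covariance matrix $\Sigma$, and let $S$ be a multiset of $n$ i.i.d. samples from $P$. Let $\epsilon \ge 0$, $0 < \tau < 1$, and let $T$ be an $\epsilon$-corruption of $S$: an adversary who has inspected $S$ removes up to $\epsilon n$ of the points and replaces them by equally many arbitrary points. Let $\epsilon'$ satisfy $K(\epsilon + \log(1/\tau)/n) \le \epsilon' \le 1$, and suppose that $k = \lfloor \epsilon' n \rfloor \ge 1$. List $T$ in an arbitrary order, possibly chosen by the adversary, apply a uniformly random permutation that is independent of $S$ and of the listed $T$, split the first $k\lfloor n/k\rfloor$ points into $k$ consecutive buckets of size $\lfloor n/k \rfloor$ (discarding the remaining points), and let $T_k$ be the multiset of the $k$ bucket means. Then, with probability at least $1-\tau$, $T_k$ is a $0.01$-corruption of a multiset $S_k$ of $k$ points for which there is $S_k' \subseteq S_k$ with $|S_k'| \ge 0.95\,k$ such that $S_k'$ is $(0.1, \delta)$-stable with respect to $\mu$ and $k\|\Sigma\|/n$, where $$\delta = C\left(\sqrt{\operatorname{r}(\Sigma)/k}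 + 1\right).$$ Here $\|\Sigma\|$ is the spectral norm and $\operatorname{r}(\Sigma) = \operatorname{tr}(\Sigma)/\|\Sigma\|$ is the stable rank (read as $0$ if $\Sigma = 0$). For $0<\alpha<1/2$ and $\delta \ge \alpha$, a finite multiset $R$ is $(\alpha,\delta)$-stable with respect to $\mu$ and $\sigma^2$ if every $R' \subseteq R$ with $|R'| \ge (1-\alpha)|R|$ satisfies $$\Big\|\tfrac{1}{|R'|}\sum_{x\in R'} x - \mu\Big\| \le \sigma\delta \quad\text{and}\quad \Big\|\tfrac{1}{|R'|}\sum_{x\in R'}(x-\mu)(x-\mu)^T - \sigma^2 I\Big\| \le \sigma^2\delta^2/\alpha .$$ -/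

import Mathlib

open MeasureTheory ProbabilityTheory

noncomputable section

namespace MoMStability

/-- `ℝ^d` with the Euclidean norm. -/
abbrev Vec (d : ℕ) : Type := EuclideanSpace ℝ (Fin d)

/-- The spectral norm of a square real matrix: the operator norm of the linear map it induces
on Euclidean space. -/
def specNorm {d : ℕ} (M : Matrix (Fin d) (Fin d) ℝ) : ℝ :=
  ‖Matrix.toEuclideanCLM (n := Fin d) (𝕜 := ℝ) M‖

/-- The stable rank `tr M / ‖M‖` (equal to `0` for the zero matrix). -/
def stableRank {d : ℕ} (M : Matrix (Fin d) (Fin d) ℝ) : ℝ :=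
  M.trace / specNorm M

/-- The covariance matrix of a distribution on `ℝ^d`. -/
def covMat {d : ℕ} (P : Measure (Vec d)) : Matrix (Fin d) (Fin d) ℝ :=
  Matrix.of fun i j => covariance (fun x : Vec d => x i) (fun x : Vec d => x j) P

/-- The mean of a finite multiset of points. -/
def msMean {d : ℕ} (S : Multiset (Vec d)) : Vec d :=
  (S.card : ℝ)⁻¹ • S.sum

/-- The second moment matrix of a finite multiset of points, centered at `μ`. -/
def secondMoment {d : ℕ} (μ : Vec d) (S : Multiset (Vec d)) : Matrix (Fin d) (Fin d) ℝ :=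
  (S.card : ℝ)⁻¹ • (S.map fun x => Matrix.vecMulVec (x - μ).ofLp (x - μ).ofLp).sum

/-- `S` is `(ε, δ)`-stable with respect to the mean `μ` and the variance parameter
`v = σ²`. -/
def IsStableSet {d : ℕ} (ε δ : ℝ) (μ : Vec d) (v : ℝ) (S : Multiset (Vec d)) : Prop :=
  0 < ε ∧ ε < 1 / 2 ∧ ε ≤ δ ∧
    ∀ S' ≤ S, (1 - ε) * (S.card : ℝ) ≤ (S'.card : ℝ) →
      ‖msMean S' - μ‖ ≤ Real.sqrt v * δ ∧
      specNorm (secondMoment μ S' - v • (1 : Matrix (Fin d) (Fin d) ℝ)) ≤ v * δ ^ 2 / ε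

/-- `T` is an `ε`-corruption of `S`: up to `ε |S|` points of `S` are removed and replaced by
equally many arbitrary points. -/
def IsCorruption {E : Type*} (ε : ℝ) (S T : Multiset E) : Prop :=
  ∃ U R A : Multiset E, S = U + R ∧ T = U + A ∧ A.card = R.card ∧
    (R.card : ℝ) ≤ ε * (S.card : ℝ)

/-- The multiset of the entries of a tuple. -/
def toMultiset {E : Type*} {n : ℕ} (x : Fin n → E) : Multiset E :=
  Finset.univ.val.map x

theorem bucket_index_lt {n k : ℕ} (b : Fin k) (j : Fin (n / k)) :
    b.val * (n / k) + j.val < n := by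
  have hb : b.val + 1 ≤ k := b.isLt
  calc b.val * (n / k) + j.val < b.val * (n / k) + n / k := Nat.add_lt_add_left j.isLt _
    _ = (b.val + 1) * (n / k) := by ring
    _ ≤ k * (n / k) := Nat.mul_le_mul_right _ hb
    _ ≤ n := Nat.mul_div_le n k

/-- The mean of the `b`-th of `k` consecutive buckets of size `⌊n / k⌋` of a tuple of length
`n`; the last `n - k ⌊n / k⌋` entries are discarded. -/
def bucketMean {d n : ℕ} (k : ℕ) (w : Fin n → Vec d) (b : Fin k) : Vec d :=
  ((n / k : ℕ) : ℝ)⁻¹ • ∑ j : Fin (n / k), w ⟨b.val * (n / k) + j.val, bucket_index_lt b j⟩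

/-- Median-of-means preprocessing: shuffle the data by `σ`, split it into `k` buckets of equal
size and output the multiset of the `k` bucket means. -/
def momPreprocess {d n : ℕ} (k : ℕ) (t : Fin n → Vec d) (σ : Equiv.Perm (Fin n)) :
    Multiset (Vec d) :=
  toMultiset (bucketMean k fun i => t (σ i))

/-- Permutations of `{1, …, n}` carry the discrete σ-algebra. -/
instance instMeasurableSpacePerm (n : ℕ) : MeasurableSpace (Equiv.Perm (Fin n)) := ⊤

end MoMStability

end

open MoMStability

/-!
Matching the points of `T` with those of the sample changes at most `0.01 k` bucket means, and the
random permutation makes the order of the sample irrelevant; so it suffices to treat the means of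
consecutive buckets of an i.i.d. sample. A PAC-Bayes bound, with a Gaussian prior and its
translates as posteriors, combined with Chebyshev's inequality in each direction, shows that with
probability `1 - exp (-k / 1000)`, every direction has only few centered bucket means whose
projection exceeds a constant times `√((k ‖Σ‖ + tr Σ) / n)`. The exceptions depend on the
direction. To find few exceptions that serve all directions, a minimax theorem replaces directions
by positive semidefinite matrices of trace at most one, and a Gaussian vector with such a covariance
matrix brings the claim for matrices back to the one for vectors. Discarding the few exceptional
bucket means bounds the second moments in all directions at once, which in turn bounds the means of
all large subsets; this is stability.
-/

namespace MoMStability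

open scoped RealInnerProductSpace Finset ENNReal Matrix

section Gaussian

/-- The Lebesgue density of the standard Gaussian measure. -/
noncomputable def gaussianDensity {E : Type*} [NormedAddCommGroup E] [InnerProductSpace ℝ E]
    (x : E) : ℝ :=
  ((2 * Real.pi) ^ (Module.finrank ℝ E / 2 : ℝ))⁻¹ * Real.exp (-(1 / 2) * ‖x‖ ^ 2)

variable {E : Type*} [NormedAddCommGroup E] [InnerProductSpace ℝ E]

lemma gaussianDensity_nonneg (x : E) : 0 ≤ gaussianDensity x := by
  unfold gaussianDensity; positivity

lemma gaussianDensity_add (u x : E) :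
    gaussianDensity (u + x) = gaussianDensity x * Real.exp (-⟪u, x⟫ - ‖u‖ ^ 2 / 2) := by
  simp only [gaussianDensity]
  rw [mul_assoc, ← Real.exp_add, norm_add_sq_real]
  ring_nf

variable [MeasurableSpace E] [BorelSpace E]

lemma measurable_gaussianDensity : Measurable (gaussianDensity : E → ℝ) := by
  unfold gaussianDensity; fun_prop

variable [FiniteDimensional ℝ E]

lemma integral_gaussianDensity : ∫ x : E, gaussianDensity x = 1 := by
  unfold gaussianDensity
  rw [integral_const_mul, GaussianFourier.integral_rexp_neg_mul_sq_norm (by norm_num),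
    show Real.pi / (1 / 2) = 2 * Real.pi by ring]
  exact inv_mul_cancel₀ (by positivity)

lemma isProbabilityMeasure_withDensity_gaussianDensity :
    IsProbabilityMeasure
      ((volume : Measure E).withDensity fun x ↦ ENNReal.ofReal (gaussianDensity x)) := by
  have hint : Integrable (gaussianDensity : E → ℝ) :=
    .of_integral_ne_zero (by simp [integral_gaussianDensity])
  constructor
  rw [withDensity_apply _ MeasurableSet.univ, Measure.restrict_univ,
    ← ofReal_integral_eq_lintegral_ofReal hint (ae_of_all _ gaussianDensity_nonneg),
    integral_gaussianDensity, ENNReal.ofReal_one]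

lemma integral_gaussianDensity_smul_cexp (t : E) :
    ∫ x : E, gaussianDensity x • Complex.exp (⟪x, t⟫ * Complex.I) =
      Complex.exp (-(‖t‖ : ℂ) ^ 2 / 2) := by
  have hexp (x : E) : gaussianDensity x • Complex.exp (⟪x, t⟫ * Complex.I) =
      (((2 * Real.pi) ^ (Module.finrank ℝ E / 2 : ℝ) : ℝ) : ℂ)⁻¹ *
        Complex.exp (-(1 / 2 : ℂ) * ‖x‖ ^ 2 + Complex.I * ⟪t, x⟫) := by
    rw [gaussianDensity, Complex.exp_add, real_inner_comm, Complex.real_smul]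
    push_cast
    ring_nf
  have hconst : (((2 * Real.pi) ^ (Module.finrank ℝ E / 2 : ℝ) : ℝ) : ℂ) =
      ((Real.pi : ℂ) / (1 / 2)) ^ (Module.finrank ℝ E / 2 : ℂ) := by
    rw [Complex.ofReal_cpow (by positivity)]
    push_cast
    ring_nf
  simp_rw [hexp]
  rw [integral_const_mul, GaussianFourier.integral_cexp_neg_mul_sq_norm_add (by norm_num),
    ← hconst, ← mul_assoc, inv_mul_cancel₀ (by rw [Complex.ofReal_ne_zero]; positivity), one_mul,
    Complex.I_sq]
  ring_nf

lemma stdGaussian_eq_withDensity :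
    stdGaussian E =
      (volume : Measure E).withDensity fun x ↦ ENNReal.ofReal (gaussianDensity x) := by
  have := isProbabilityMeasure_withDensity_gaussianDensity (E := E)
  refine Measure.ext_of_charFun (funext fun t ↦ ?_)
  rw [charFun_stdGaussian, charFun_apply, integral_withDensity_eq_integral_toReal_smul
    measurable_gaussianDensity.ennreal_ofReal (ae_of_all _ fun _ ↦ ENNReal.ofReal_lt_top)]
  simp only [ENNReal.toReal_ofReal (gaussianDensity_nonneg _), integral_gaussianDensity_smul_cexp]

lemma lintegral_stdGaussian_add_left (u : E) {F : E → ℝ≥0∞} (hF : Measurable F) :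
    ∫⁻ x, F (u + x) * ENNReal.ofReal (Real.exp (-⟪u, x⟫ - ‖u‖ ^ 2 / 2)) ∂stdGaussian E =
      ∫⁻ x, F x ∂stdGaussian E := by
  have hm := (measurable_gaussianDensity (E := E)).ennreal_ofReal
  rw [stdGaussian_eq_withDensity, lintegral_withDensity_eq_lintegral_mul _ hm hF,
    lintegral_withDensity_eq_lintegral_mul _ hm (by fun_prop),
    ← lintegral_add_left_eq_self (μ := volume) ((fun x ↦ ENNReal.ofReal (gaussianDensity x)) * F) u]
  refine lintegral_congr fun x ↦ ?_
  simp only [Pi.mul_apply, gaussianDensity_add, ENNReal.ofReal_mul (gaussianDensity_nonneg x)]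
  ring

lemma ofReal_integral_le_lintegral_ofReal {α : Type*} {m : MeasurableSpace α} {μ : Measure α}
    {f : α → ℝ} (hf : Integrable f μ) :
    ENNReal.ofReal (∫ x, f x ∂μ) ≤ ∫⁻ x, ENNReal.ofReal (f x) ∂μ := by
  rw [integral_eq_lintegral_pos_part_sub_lintegral_neg_part hf]
  exact (ENNReal.ofReal_le_ofReal (sub_le_self _ ENNReal.toReal_nonneg)).trans
    ENNReal.ofReal_toReal_le

lemma ofReal_exp_integral_le_lintegral {α : Type*} {m : MeasurableSpace α} {μ : Measure α}
    [IsProbabilityMeasure μ] {g : α → ℝ} (hg : Integrable g μ) :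
    ENNReal.ofReal (Real.exp (∫ x, g x ∂μ)) ≤ ∫⁻ x, ENNReal.ofReal (Real.exp (g x)) ∂μ := by
  set c := ∫ x, g x ∂μ with hc
  have tangent (y : ℝ) : Real.exp c * (1 + (y - c)) ≤ Real.exp y := by
    calc Real.exp c * (1 + (y - c)) ≤ Real.exp c * Real.exp (y - c) := by
          gcongr; linarith [Real.add_one_le_exp (y - c)]
      _ = Real.exp y := by rw [← Real.exp_add, add_sub_cancel]
  have integral_tangent : ∫ x, Real.exp c * (1 + (g x - c)) ∂μ = Real.exp c := by
    rw [integral_const_mul, integral_add (by fun_prop) (by fun_prop),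
      integral_sub hg (by fun_prop)]
    simp [← hc]
  calc ENNReal.ofReal (Real.exp c)
      = ENNReal.ofReal (∫ x, Real.exp c * (1 + (g x - c)) ∂μ) := by rw [integral_tangent]
    _ ≤ ∫⁻ x, ENNReal.ofReal (Real.exp c * (1 + (g x - c))) ∂μ :=
        ofReal_integral_le_lintegral_ofReal (by fun_prop)
    _ ≤ ∫⁻ x, ENNReal.ofReal (Real.exp (g x)) ∂μ :=
        lintegral_mono fun x ↦ ENNReal.ofReal_le_ofReal (tangent (g x))

/-- The Gibbs variational inequality: `‖u‖ ^ 2 / 2` is the relative entropy between the standard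
Gaussian and its translate by `u`. -/
lemma ofReal_exp_integral_add_left_le (u : E) {h : E → ℝ} (hm : Measurable h)
    (hi : Integrable (fun x ↦ h (u + x)) (stdGaussian E)) :
    ENNReal.ofReal (Real.exp (∫ x, h (u + x) ∂stdGaussian E - ‖u‖ ^ 2 / 2)) ≤
      ∫⁻ x, ENNReal.ofReal (Real.exp (h x)) ∂stdGaussian E := by
  have hu : Integrable (fun x : E ↦ ⟪u, x⟫) (stdGaussian E) :=
    IsGaussian.integrable_dual (stdGaussian E) (innerSL ℝ u)
  have integral_inner : ∫ x : E, ⟪u, x⟫ ∂stdGaussian E = 0 :=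
    integral_strongDual_stdGaussian (innerSL ℝ u)
  have hshift : Integrable (fun x : E ↦ ⟪u, x⟫ + ‖u‖ ^ 2 / 2) (stdGaussian E) :=
    hu.add (integrable_const _)
  have integral_eq : ∫ x, (h (u + x) - (⟪u, x⟫ + ‖u‖ ^ 2 / 2)) ∂stdGaussian E =
      ∫ x, h (u + x) ∂stdGaussian E - ‖u‖ ^ 2 / 2 := by
    rw [integral_sub hi hshift, integral_add hu (integrable_const _), integral_inner]
    simp
  rw [← integral_eq, ← lintegral_stdGaussian_add_left u (by fun_prop)]
  refine (ofReal_exp_integral_le_lintegral (hi.sub hshift)).trans_eq (lintegral_congr fun x ↦ ?_)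
  rw [← ENNReal.ofReal_mul (by positivity), ← Real.exp_add, Pi.sub_apply]
  ring_nf

lemma half_le_stdGaussian_inner_nonneg (z : E) :
    1 / 2 ≤ (stdGaussian E).real {x | 0 ≤ ⟪x, z⟫} := by
  have map_neg : (stdGaussian E).map (fun x ↦ -x) = stdGaussian E := by
    simpa using stdGaussian_map (E := E) (LinearIsometryEquiv.neg ℝ)
  have symm : (stdGaussian E).real {x | 0 ≤ ⟪x, z⟫} = (stdGaussian E).real {x | ⟪x, z⟫ ≤ 0} := by
    conv_lhs => rw [← map_neg]
    rw [map_measureReal_apply (by fun_prop) (measurableSet_le (by fun_prop) (by fun_prop))]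
    simp
  have cover : {x : E | 0 ≤ ⟪x, z⟫} ∪ {x | ⟪x, z⟫ ≤ 0} = Set.univ := by
    ext x; simp [le_total]
  have := measureReal_union_le (μ := stdGaussian E) {x | 0 ≤ ⟪x, z⟫} {x | ⟪x, z⟫ ≤ 0}
  rw [cover, probReal_univ, ← symm] at this
  linarith

lemma half_le_stdGaussian_lt_abs_inner_add {u z : E} {q : ℝ} (h : q < |⟪u, z⟫|) :
    1 / 2 ≤ (stdGaussian E).real {x | q < |⟪u + x, z⟫|} := by
  rcases le_total 0 ⟪u, z⟫ with h0 | h0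
  · refine (half_le_stdGaussian_inner_nonneg z).trans
      (measureReal_mono fun x (hx : 0 ≤ ⟪x, z⟫) ↦ show q < |⟪u + x, z⟫| from ?_)
    rw [abs_of_nonneg h0] at h
    rw [inner_add_left]
    exact lt_abs.2 (.inl (by linarith))
  · refine (half_le_stdGaussian_inner_nonneg (-z)).trans
      (measureReal_mono fun x (hx : 0 ≤ ⟪x, -z⟫) ↦ show q < |⟪u + x, z⟫| from ?_)
    rw [abs_of_nonpos h0] at h
    rw [inner_neg_right] at hx
    rw [inner_add_left]
    exact lt_abs.2 (.inr (by linarith))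

end Gaussian

section PACBayes

variable {Ω : Type*} [MeasurableSpace Ω] {Pr : Measure Ω} [IsProbabilityMeasure Pr]

section Counting

variable {ι : Type*} [Fintype ι] {s : ι → Set Ω}

lemma mgf_indicator_one_le {s : Set Ω} (hs : MeasurableSet s) :
    mgf (s.indicator 1) Pr 1 ≤ Real.exp (2 * Pr.real s) := by
  have hexp (ω : Ω) : Real.exp (1 * s.indicator (1 : Ω → ℝ) ω) =
      1 + (Real.exp 1 - 1) * s.indicator 1 ω := by
    by_cases h : ω ∈ s <;> simp [h]
  have hint : Integrable (s.indicator (1 : Ω → ℝ)) Pr := (integrable_const 1).indicator hs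
  calc mgf (s.indicator 1) Pr 1 = 1 + (Real.exp 1 - 1) * Pr.real s := by
        simp only [mgf, hexp]
        rw [integral_add (by fun_prop) (hint.const_mul _), integral_const_mul,
          integral_indicator_one hs]
        simp
    _ ≤ 2 * Pr.real s + 1 := by
        nlinarith [Real.exp_one_lt_d9, measureReal_nonneg (μ := Pr) (s := s)]
    _ ≤ Real.exp (2 * Pr.real s) := Real.add_one_le_exp _

lemma integral_exp_sum_indicator_le (hs : ∀ i, MeasurableSet (s i)) (hind : iIndepSet s Pr) :
    ∫ ω, Real.exp (∑ i, (s i).indicator 1 ω) ∂Pr ≤ Real.exp (2 * ∑ i, Pr.real (s i)) := by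
  have hmgf := (hind.iIndepFun_indicator (β := ℝ)).mgf_sum (t := 1)
    (fun i ↦ measurable_one.indicator (hs i)) Finset.univ
  calc ∫ ω, Real.exp (∑ i, (s i).indicator 1 ω) ∂Pr
      = ∏ i, mgf ((s i).indicator 1) Pr 1 := by
        refine Eq.trans ?_ hmgf
        simp only [mgf, one_mul, Finset.sum_apply]
        rfl
    _ ≤ ∏ i, Real.exp (2 * Pr.real (s i)) :=
        Finset.prod_le_prod (fun _ _ ↦ mgf_nonneg) fun i _ ↦ mgf_indicator_one_le (hs i)
    _ = Real.exp (2 * ∑ i, Pr.real (s i)) := by rw [← Real.exp_sum, Finset.mul_sum]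

lemma lintegral_exp_sum_indicator_sub_le_one (hs : ∀ i, MeasurableSet (s i))
    (hind : iIndepSet s Pr) :
    ∫⁻ ω, ENNReal.ofReal
      (Real.exp (∑ i, (s i).indicator 1 ω - 2 * ∑ i, Pr.real (s i))) ∂Pr ≤ 1 := by
  set M := ∑ i, Pr.real (s i)
  have hm (i : ι) : Measurable ((s i).indicator (1 : Ω → ℝ)) := measurable_one.indicator (hs i)
  have hint : Integrable (fun ω ↦ Real.exp (∑ i, (s i).indicator (1 : Ω → ℝ) ω - 2 * M)) Pr := by
    refine .of_bound (by fun_prop) (Real.exp (Fintype.card ι - 2 * M)) (ae_of_all _ fun ω ↦ ?_)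
    rw [Real.norm_eq_abs, Real.abs_exp, Real.exp_le_exp]
    refine sub_le_sub_right ((Finset.sum_le_card_nsmul _ _ 1 fun i _ ↦ ?_).trans (by simp)) _
    exact Set.indicator_le_self' (fun _ _ ↦ zero_le_one) ω
  rw [← ofReal_integral_eq_lintegral_ofReal hint (ae_of_all _ fun _ ↦ (Real.exp_pos _).le),
    ENNReal.ofReal_le_one]
  simp only [sub_eq_add_neg, Real.exp_add]
  rw [integral_mul_const, Real.exp_neg]
  exact mul_inv_le_one_of_le₀ (integral_exp_sum_indicator_le hs hind) (Real.exp_pos _).le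

end Counting

variable {E : Type*} [NormedAddCommGroup E] [InnerProductSpace ℝ E] [FiniteDimensional ℝ E]
  [MeasurableSpace E] [BorelSpace E]

/-- The PAC-Bayes inequality with a Gaussian prior and its translates as posteriors. -/
lemma measure_exists_lt_integral_stdGaussian_le {h : Ω → E → ℝ}
    (hm : Measurable (Function.uncurry h))
    (hexp : ∀ θ, ∫⁻ ω, ENNReal.ofReal (Real.exp (h ω θ)) ∂Pr ≤ 1)
    (hint : ∀ ω u, Integrable (fun x ↦ h ω (u + x)) (stdGaussian E)) (t : ℝ) :
    Pr {ω | ∃ u : E, t < ∫ x, h ω (u + x) ∂stdGaussian E - ‖u‖ ^ 2 / 2} ≤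
      ENNReal.ofReal (Real.exp (-t)) := by
  set W : Ω → ℝ≥0∞ := fun ω ↦ ∫⁻ θ, ENNReal.ofReal (Real.exp (h ω θ)) ∂stdGaussian E with hW
  have hWm : Measurable W :=
    Measurable.lintegral_prod_right' (f := fun x : Ω × E ↦ ENNReal.ofReal (Real.exp (h x.1 x.2)))
      (by fun_prop)
  have hEW : ∫⁻ ω, W ω ∂Pr ≤ 1 := by
    rw [hW, lintegral_lintegral_swap (by unfold Function.uncurry; fun_prop)]
    exact (lintegral_mono hexp).trans (by simp)
  have markov : Pr {ω | ENNReal.ofReal (Real.exp t) ≤ W ω} ≤ ENNReal.ofReal (Real.exp (-t)) := by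
    rw [Real.exp_neg, ENNReal.ofReal_inv_of_pos (Real.exp_pos t), ENNReal.le_inv_iff_mul_le,
      mul_comm]
    exact (mul_meas_ge_le_lintegral hWm _).trans hEW
  refine le_trans (measure_mono ?_) markov
  rintro ω ⟨u, hu⟩
  exact (ENNReal.ofReal_le_ofReal (Real.exp_le_exp.2 hu.le)).trans
    (ofReal_exp_integral_add_left_le u (by fun_prop) (hint ω u))

variable {ι : Type*} [Fintype ι]

lemma integrable_indicator_one_comp {α β : Type*} {_ : MeasurableSpace α}
    {_ : MeasurableSpace β} {ν : Measure α} [IsFiniteMeasure ν] {s : Set β}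
    (hs : MeasurableSet s) {g : α → β} (hg : Measurable g) :
    Integrable (fun x ↦ s.indicator (1 : β → ℝ) (g x)) ν :=
  .of_bound ((measurable_one.indicator hs).comp hg).aestronglyMeasurable 1
    (ae_of_all _ fun x ↦ by by_cases h : g x ∈ s <;> simp [h])

lemma integral_indicator_one_comp {α β : Type*} {_ : MeasurableSpace α}
    {_ : MeasurableSpace β} {ν : Measure α} {s : Set β}
    (hs : MeasurableSet s) {g : α → β} (hg : Measurable g) :
    ∫ x, s.indicator (1 : β → ℝ) (g x) ∂ν = ν.real (g ⁻¹' s) :=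
  integral_indicator_one (hg hs)

/-- The last sum is the number of events `s i` that occur at parameter `θ`, averaged over
`θ = u + x` with `x` Gaussian. -/
lemma measure_exists_lt_sum_stdGaussian_le {s : ι → Set (Ω × E)} (hs : ∀ i, MeasurableSet (s i))
    (hind : ∀ θ, iIndepSet (fun i ↦ (·, θ) ⁻¹' s i) Pr) (t : ℝ) :
    Pr {ω | ∃ u : E, t + ‖u‖ ^ 2 / 2 +
        2 * ∑ i, ∫ x, Pr.real ((·, u + x) ⁻¹' s i) ∂stdGaussian E <
          ∑ i, (stdGaussian E).real ((fun x ↦ (ω, u + x)) ⁻¹' s i)} ≤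
      ENNReal.ofReal (Real.exp (-t)) := by
  have hpm (i : ι) : Measurable fun θ : E ↦ Pr.real ((·, θ) ⁻¹' s i) :=
    (measurable_measure_prodMk_right (hs i)).ennreal_toReal
  have hsm (i : ι) : Measurable ((s i).indicator (1 : Ω × E → ℝ)) := measurable_one.indicator (hs i)
  have hpi (i : ι) (u : E) :
      Integrable (fun x ↦ Pr.real ((·, u + x) ⁻¹' s i)) (stdGaussian E) :=
    .of_bound ((hpm i).comp (measurable_const_add u)).aestronglyMeasurable 1
      (ae_of_all _ fun x ↦ by simp [abs_of_nonneg, measureReal_le_one])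
  have hsi (i : ι) (ω : Ω) (u : E) :
      Integrable (fun x ↦ (s i).indicator (1 : Ω × E → ℝ) (ω, u + x)) (stdGaussian E) :=
    integrable_indicator_one_comp (hs i) (by fun_prop)
  have hsum (ω : Ω) (u : E) := integrable_finsetSum Finset.univ fun i _ ↦ hsi i ω u
  have hpsum (u : E) := (integrable_finsetSum Finset.univ fun i _ ↦ hpi i u).const_mul 2
  refine le_trans (measure_mono ?_) (measure_exists_lt_integral_stdGaussian_le (Pr := Pr)
    (h := fun ω θ ↦ ∑ i, (s i).indicator 1 (ω, θ) - 2 * ∑ i, Pr.real ((·, θ) ⁻¹' s i))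
    ((Finset.measurable_sum _ fun i _ ↦ hsm i).sub
      ((Finset.measurable_sum _ fun i _ ↦ (hpm i).comp measurable_snd).const_mul 2))
    (fun θ ↦ lintegral_exp_sum_indicator_sub_le_one (fun i ↦ measurable_prodMk_right (hs i))
      (hind θ))
    (fun ω u ↦ (hsum ω u).sub (hpsum u)) t)
  rintro ω ⟨u, hu⟩
  refine ⟨u, ?_⟩
  have hmean (i : ι) : ∫ x, (s i).indicator (1 : Ω × E → ℝ) (ω, u + x) ∂stdGaussian E =
      (stdGaussian E).real ((fun x ↦ (ω, u + x)) ⁻¹' s i) :=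
    integral_indicator_one_comp (hs i) (by fun_prop)
  rw [integral_sub (hsum ω u) (hpsum u), integral_const_mul,
    integral_finsetSum _ fun i _ ↦ hsi i ω u, integral_finsetSum _ fun i _ ↦ hpi i u]
  simp only [hmean]
  linarith

open Classical in
lemma measure_exists_lt_card_lt_abs_inner_le {Z : ι → Ω → E} (hZ : ∀ i, Measurable (Z i))
    (hind : iIndepFun Z Pr) (q t : ℝ) :
    Pr {ω | ∃ u : E, 2 * (t + ‖u‖ ^ 2 / 2 +
        2 * ∑ i, ∫ x, Pr.real {ω | q < |⟪u + x, Z i ω⟫|} ∂stdGaussian E) <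
          #{i | q < |⟪u, Z i ω⟫|}} ≤
      ENNReal.ofReal (Real.exp (-t)) := by
  set s : ι → Set (Ω × E) := fun i ↦ {x | q < |⟪x.2, Z i x.1⟫|} with hs
  have hsm (i : ι) : MeasurableSet (s i) := measurableSet_lt (by fun_prop) (by fun_prop)
  have hsind (θ : E) : iIndepSet (fun i ↦ (·, θ) ⁻¹' s i) Pr := by
    rw [iIndepSet_iff_meas_biInter fun i ↦ measurable_prodMk_right (hsm i)]
    exact fun S ↦ hind.measure_inter_preimage_eq_mul S (sets := fun _ ↦ {z | q < |⟪θ, z⟫|})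
      fun _ _ ↦ measurableSet_lt (by fun_prop) (by fun_prop)
  refine le_trans (measure_mono ?_) (measure_exists_lt_sum_stdGaussian_le hsm hsind t)
  rintro ω ⟨u, hu⟩
  refine ⟨u, ?_⟩
  have hcount : (#{i | q < |⟪u, Z i ω⟫|} : ℝ) * (1 / 2) ≤
      ∑ i, (stdGaussian E).real {x | q < |⟪u + x, Z i ω⟫|} := by
    rw [← nsmul_eq_mul]
    refine (Finset.card_nsmul_le_sum _ _ _ fun i hi ↦ ?_).trans
      (Finset.sum_le_univ_sum_of_nonneg fun _ ↦ measureReal_nonneg)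
    exact half_le_stdGaussian_lt_abs_inner_add (Finset.mem_filter.1 hi).2
  simp only [hs, Set.preimage_ofPred_eq]
  linarith

end PACBayes

section Rounding

open scoped NNReal Matrix MatrixOrder

lemma gaussianReal_Icc_le {v : ℝ≥0} (hv : v ≠ 0) {q : ℝ} (hq : 0 ≤ q) :
    (gaussianReal 0 v).real (Set.Icc (-q) q) ≤ (√(2 * Real.pi * v))⁻¹ * (2 * q) := by
  have hpdf (x : ℝ) : gaussianPDFReal 0 v x ≤ (√(2 * Real.pi * v))⁻¹ := by
    refine mul_le_of_le_one_right (by positivity) (Real.exp_le_one_iff.2 ?_)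
    exact div_nonpos_of_nonpos_of_nonneg (by simp [sq_nonneg]) (by positivity)
  rw [measureReal_def, gaussianReal_apply_eq_integral _ hv,
    ENNReal.toReal_ofReal (integral_nonneg fun _ ↦ gaussianPDFReal_nonneg _ _ _)]
  calc ∫ x in Set.Icc (-q) q, gaussianPDFReal 0 v x
      ≤ ∫ _ in Set.Icc (-q) q, (√(2 * Real.pi * v))⁻¹ :=
        setIntegral_mono (integrable_gaussianPDFReal _ _).integrableOn
          (integrableOn_const (by simp)) hpdf
    _ = (√(2 * Real.pi * v))⁻¹ * (2 * q) := by
        rw [setIntegral_const, Real.volume_real_Icc_of_le (by linarith), smul_eq_mul]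
        ring

lemma third_le_gaussianReal_lt_abs {v : ℝ≥0} {q : ℝ} (hq : 0 ≤ q) (h : 2 * q ^ 2 < v) :
    1 / 3 ≤ (gaussianReal 0 v).real {x | q < |x|} := by
  have hv : (0 : ℝ) < v := by nlinarith
  have hsqrt : 3 * q ≤ √(2 * Real.pi * v) :=
    Real.le_sqrt_of_sq_le (by nlinarith [Real.pi_gt_three])
  have hsmall : (gaussianReal 0 v).real (Set.Icc (-q) q) ≤ 2 / 3 := by
    refine (gaussianReal_Icc_le (by exact_mod_cast hv.ne') hq).trans ?_
    rw [inv_mul_le_iff₀ (by positivity)]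
    linarith
  have hcompl : {x : ℝ | q < |x|} = (Set.Icc (-q) q)ᶜ := by
    ext x; simp [← abs_le]
  rw [hcompl, probReal_compl_eq_one_sub measurableSet_Icc]
  linarith

variable {ι : Type*} [Fintype ι] {S : Matrix ι ι ℝ}

section MultivariateGaussian

variable [DecidableEq ι]

lemma map_inner_multivariateGaussian_zero (hS : S.PosSemidef) (z : EuclideanSpace ℝ ι) :
    (multivariateGaussian 0 S).map (fun y ↦ ⟪z, y⟫) = gaussianReal 0 (z ⬝ᵥ S *ᵥ z).toNNReal := by
  have h := IsGaussian.map_eq_gaussianReal (μ := multivariateGaussian 0 S) (innerSL ℝ z)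
  have hmean : (multivariateGaussian 0 S)[innerSL ℝ z] = 0 := by
    rw [ContinuousLinearMap.integral_comp_id_comm IsGaussian.integrable_id,
      integral_id_multivariateGaussian, map_zero]
  rw [hmean] at h
  rw [← covarianceBilin_multivariateGaussian (μ := 0) hS,
    covarianceBilin_self IsGaussian.memLp_two_id]
  exact h

lemma integrable_norm_sq_multivariateGaussian {μ : EuclideanSpace ℝ ι} :
    Integrable (fun y ↦ ‖y‖ ^ 2) (multivariateGaussian μ S) :=
  (memLp_two_iff_integrable_sq_norm (by fun_prop)).1 IsGaussian.memLp_two_id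

lemma integral_norm_sq_multivariateGaussian_zero (hS : S.PosSemidef) :
    ∫ y, ‖y‖ ^ 2 ∂multivariateGaussian 0 S = S.trace := by
  have hcoord (i : ι) : MemLp (fun y : EuclideanSpace ℝ ι ↦ y i) 2 (multivariateGaussian 0 S) :=
    IsGaussian.memLp_dual (multivariateGaussian 0 S) (EuclideanSpace.proj i) 2 (by simp)
  have hmean (i : ι) : ∫ y, y i ∂multivariateGaussian 0 S = 0 := by
    simpa using ContinuousLinearMap.integral_comp_id_comm
      (IsGaussian.integrable_id (μ := multivariateGaussian 0 S)) (EuclideanSpace.proj (𝕜 := ℝ) i)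
  simp only [EuclideanSpace.norm_sq_eq, Real.norm_eq_abs, sq_abs]
  rw [integral_finsetSum _ fun i _ ↦ (hcoord i).integrable_sq, Matrix.trace]
  refine Finset.sum_congr rfl fun i _ ↦ ?_
  rw [Matrix.diag_apply, ← variance_eval_multivariateGaussian (μ := 0) hS,
    variance_of_integral_eq_zero (hcoord i).aemeasurable (hmean i)]

end MultivariateGaussian

variable {κ : Type*} [Fintype κ]

open Classical in
/-- Gaussian rounding: a centered Gaussian vector with covariance matrix `S` has a large inner
product with `z i` with constant probability whenever `z i ⬝ᵥ S *ᵥ z i` is large. -/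
lemma card_lt_dotProduct_mulVec_le {z : κ → EuclideanSpace ℝ ι} {q A B : ℝ} (hq : 0 ≤ q)
    (h : ∀ y, (#{i | q < |⟪z i, y⟫|} : ℝ) ≤ A + B * ‖y‖ ^ 2) (hS : S.PosSemidef) :
    (#{i | 2 * q ^ 2 < z i ⬝ᵥ S *ᵥ z i} : ℝ) ≤ 3 * (A + B * S.trace) := by
  set γ := multivariateGaussian 0 S
  have hs (i : κ) : MeasurableSet {y | q < |⟪z i, y⟫|} :=
    measurableSet_lt (by fun_prop) (by fun_prop)
  have hprob (i : κ) (hi : 2 * q ^ 2 < z i ⬝ᵥ S *ᵥ z i) :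
      1 / 3 ≤ γ.real {y | q < |⟪z i, y⟫|} := by
    have := third_le_gaussianReal_lt_abs hq (hi.trans_le (Real.le_coe_toNNReal _))
    rwa [← map_inner_multivariateGaussian_zero hS, map_measureReal_apply (by fun_prop)
      (measurableSet_lt (by fun_prop) (by fun_prop))] at this
  have hint (i : κ) : Integrable ({y | q < |⟪z i, y⟫|}.indicator (1 : EuclideanSpace ℝ ι → ℝ)) γ :=
    (integrable_const 1).indicator (hs i)
  have hle : #{i | 2 * q ^ 2 < z i ⬝ᵥ S *ᵥ z i} * (1 / 3 : ℝ) ≤ A + B * S.trace :=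
    calc #{i | 2 * q ^ 2 < z i ⬝ᵥ S *ᵥ z i} * (1 / 3 : ℝ)
        ≤ ∑ i, γ.real {y | q < |⟪z i, y⟫|} := by
          rw [← nsmul_eq_mul]
          exact (Finset.card_nsmul_le_sum _ _ _ fun i hi ↦ hprob i (Finset.mem_filter.1 hi).2).trans
            (Finset.sum_le_univ_sum_of_nonneg fun _ ↦ measureReal_nonneg)
      _ = ∫ y, (∑ i, {y | q < |⟪z i, y⟫|}.indicator 1 y) ∂γ := by
          rw [integral_finsetSum _ fun i _ ↦ hint i]
          simp only [integral_indicator_one (hs _)]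
      _ ≤ ∫ y, (A + B * ‖y‖ ^ 2) ∂γ := by
          refine integral_mono (integrable_finsetSum _ fun i _ ↦ hint i)
            ((integrable_const A).add (integrable_norm_sq_multivariateGaussian.const_mul B))
            fun y ↦ le_trans (le_of_eq ?_) (h y)
          simp [Set.indicator_apply]
      _ = A + B * S.trace := by
          rw [integral_add (integrable_const A)
            (integrable_norm_sq_multivariateGaussian.const_mul B), integral_const_mul,
            integral_norm_sq_multivariateGaussian_zero hS]
          simp
  linarith

end Rounding

section Minimax

lemma exists_mem_forall_bilin_le {E F : Type*}
    [TopologicalSpace E] [AddCommGroup E] [Module ℝ E] [IsTopologicalAddGroup E]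
    [ContinuousSMul ℝ E] [TopologicalSpace F] [AddCommGroup F] [Module ℝ F]
    [IsTopologicalAddGroup F] [ContinuousSMul ℝ F]
    {f : E →ₗ[ℝ] F →ₗ[ℝ] ℝ} (hf₁ : ∀ y, Continuous (f · y)) (hf₂ : ∀ x, Continuous (f x))
    {X : Set E} {Y : Set F} (hX : X.Nonempty) (kX : IsCompact X) (cX : Convex ℝ X)
    (cY : Convex ℝ Y) {c : ℝ} (h : ∀ y ∈ Y, ∃ x ∈ X, f x y ≤ c) :
    ∃ x ∈ X, ∀ y ∈ Y, f x y ≤ c := by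
  by_contra! hcon
  obtain ⟨s, hsY, hs, hcover⟩ := kX.elim_finite_subcover_image (b := Y)
    (c := fun y ↦ {x | c < f x y}) (fun y _ ↦ isOpen_lt continuous_const (hf₁ y))
    (fun x hx ↦ by simpa using hcon x hx)
  obtain ⟨y, hy, hlt⟩ := Sion.exists_lt_iInf_of_lt_iInf_of_finite (f := fun x y ↦ f x y) hX kX
    (fun y _ ↦ (hf₁ y).continuousOn.lowerSemicontinuousOn)
    (fun y _ ↦ ((f.flip y).convexOn cX).quasiconvexOn) cY
    (fun x _ ↦ (hf₂ x).continuousOn.upperSemicontinuousOn)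
    (fun x _ ↦ ((f x).concaveOn cY).quasiconcaveOn) cX hs hsY
    (fun x hx ↦ by simpa using hcover hx)
  obtain ⟨x, hx, hle⟩ := h y hy
  exact (hlt x hx).not_ge hle

variable {κ : Type*} [Fintype κ]

open Classical in
lemma exists_weights_forall_dotProduct_le {Y : Set (κ → ℝ)} (hY : Convex ℝ Y) {M N : ℝ}
    (hM : 0 ≤ M) (hN : 0 ≤ N) (hcard : ∀ a ∈ Y, (#{i | M < a i} : ℝ) ≤ N) :
    ∃ w ∈ Set.Icc (0 : κ → ℝ) 1, Fintype.card κ - N ≤ ∑ i, w i ∧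
      ∀ a ∈ Y, w ⬝ᵥ a ≤ M * Fintype.card κ := by
  set X : Set (κ → ℝ) := Set.Icc 0 1 ∩ {w | Fintype.card κ - N ≤ ∑ i, w i}
  have neX : X.Nonempty := ⟨1, Set.right_mem_Icc.2 zero_le_one, by simp [hN]⟩
  have kX : IsCompact X := isCompact_Icc.inter_right (isClosed_le continuous_const (by fun_prop))
  have cX : Convex ℝ X := (convex_Icc 0 1).inter <|
    convex_halfSpace_ge ⟨fun x y ↦ by simp [Finset.sum_add_distrib],
      fun c x ↦ by simp [Finset.mul_sum]⟩ _
  have truncate (a) (ha : a ∈ Y) : ∃ w ∈ X, w ⬝ᵥ a ≤ M * Fintype.card κ := by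
    refine ⟨fun i ↦ if M < a i then 0 else 1, ⟨⟨fun i ↦ ?_, fun i ↦ ?_⟩, ?_⟩, ?_⟩
    · dsimp only; split_ifs <;> simp
    · dsimp only; split_ifs <;> simp
    · have hsum : ∑ i, (if M < a i then (0 : ℝ) else 1) + #{i | M < a i} = Fintype.card κ := by
        rw [Finset.card_filter, Nat.cast_sum, ← Finset.sum_add_distrib, ← Finset.card_univ,
          Finset.cast_card]
        exact Finset.sum_congr rfl fun i _ ↦ by split_ifs <;> simp
      rw [Set.mem_ofPred_eq]
      linarith [hcard a ha]
    · rw [mul_comm, ← nsmul_eq_mul]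
      refine Finset.sum_le_card_nsmul _ _ M fun i _ ↦ ?_
      dsimp only
      split_ifs with hi
      · simpa using hM
      · simpa using hi
  obtain ⟨w, hwX, hw⟩ := exists_mem_forall_bilin_le (f := dotProductBilin ℝ ℝ)
    (fun _ ↦ continuous_id.dotProduct continuous_const)
    (fun _ ↦ continuous_const.dotProduct continuous_id)
    neX kX cX hY truncate
  exact ⟨w, hwX.1, hwX.2, hw⟩

end Minimax

section Selection

variable {ι κ : Type*} [Fintype ι] [Fintype κ]

lemma convex_posSemidef_trace_le_one :
    Convex ℝ {S : Matrix ι ι ℝ | S.PosSemidef ∧ S.trace ≤ 1} := by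
  rintro S ⟨hS, hS'⟩ T ⟨hT, hT'⟩ a b ha hb hab
  refine ⟨(hS.smul ha).add (hT.smul hb), ?_⟩
  rw [Matrix.trace_add, Matrix.trace_smul, Matrix.trace_smul, smul_eq_mul, smul_eq_mul]
  nlinarith

open Classical in
lemma exists_weights_forall_sum_mul_inner_sq_le {z : κ → EuclideanSpace ℝ ι} {q A B : ℝ}
    (hq : 0 ≤ q) (hA : 0 ≤ A) (hB : 0 ≤ B)
    (h : ∀ y, (#{i | q < |⟪z i, y⟫|} : ℝ) ≤ A + B * ‖y‖ ^ 2) :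
    ∃ w ∈ Set.Icc (0 : κ → ℝ) 1, Fintype.card κ - 3 * (A + B) ≤ ∑ i, w i ∧
      ∀ y, ∑ i, w i * ⟪z i, y⟫ ^ 2 ≤ 2 * q ^ 2 * Fintype.card κ * ‖y‖ ^ 2 := by
  have hlin : IsLinearMap ℝ fun (S : Matrix ι ι ℝ) (i : κ) ↦ z i ⬝ᵥ S *ᵥ z i :=
    ⟨fun S T ↦ by ext; simp [Matrix.add_mulVec, dotProduct_add],
      fun c S ↦ by ext; simp [Matrix.smul_mulVec, dotProduct_smul]⟩
  obtain ⟨w, hw, hcard, hle⟩ := exists_weights_forall_dotProduct_le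
    (convex_posSemidef_trace_le_one.is_linear_image hlin) (M := 2 * q ^ 2) (N := 3 * (A + B))
    (by positivity) (by positivity) (by
      rintro _ ⟨S, ⟨hS, htr⟩, rfl⟩
      refine (card_lt_dotProduct_mulVec_le hq h hS).trans ?_
      nlinarith)
  refine ⟨w, hw, hcard, fun y ↦ ?_⟩
  obtain ⟨u, hu, hy⟩ : ∃ u : EuclideanSpace ℝ ι, ‖u‖ ≤ 1 ∧ y = ‖y‖ • u := by
    refine ⟨‖y‖⁻¹ • y, ?_, ?_⟩
    · simpa [norm_smul] using inv_mul_le_one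
    · rcases eq_or_ne y 0 with rfl | hy
      · simp
      · rw [smul_inv_smul₀ (norm_ne_zero_iff.2 hy)]
  have hunit : ∑ i, w i * ⟪z i, u⟫ ^ 2 ≤ 2 * q ^ 2 * Fintype.card κ := by
    refine le_trans (le_of_eq ?_) (hle _ ⟨Matrix.vecMulVec u u,
      ⟨Matrix.posSemidef_vecMulVec_self_star u.ofLp, ?_⟩, rfl⟩)
    · refine Finset.sum_congr rfl fun i _ ↦ ?_
      dsimp only
      rw [Matrix.vecMulVec_mulVec, dotProduct_smul, EuclideanSpace.inner_eq_star_dotProduct]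
      simp [dotProduct_comm, sq]
    · rw [Matrix.trace_vecMulVec]
      calc u.ofLp ⬝ᵥ u.ofLp = ‖u‖ ^ 2 := by
            rw [EuclideanSpace.real_norm_sq_eq]; simp [dotProduct, sq]
        _ ≤ 1 := pow_le_one₀ (norm_nonneg _) hu
  calc ∑ i, w i * ⟪z i, y⟫ ^ 2 = (∑ i, w i * ⟪z i, u⟫ ^ 2) * ‖y‖ ^ 2 := by
        rw [Finset.sum_mul]
        refine Finset.sum_congr rfl fun i _ ↦ ?_
        rw [hy, real_inner_smul_right, ← hy]
        ring
    _ ≤ 2 * q ^ 2 * Fintype.card κ * ‖y‖ ^ 2 := by gcongr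

lemma card_sub_le_card_half_le {w : κ → ℝ} (hw : w ≤ 1) {N : ℝ}
    (h : Fintype.card κ - N ≤ ∑ i, w i) :
    Fintype.card κ - 2 * N ≤ (#{i | 1 / 2 ≤ w i} : ℝ) := by
  have hle (i : κ) : w i ≤ (1 + if 1 / 2 ≤ w i then 1 else 0) / 2 := by
    split_ifs with hi
    · linarith [show w i ≤ 1 from hw i]
    · linarith
  have hsum := h.trans (Finset.sum_le_sum fun i _ ↦ hle i)
  rw [← Finset.sum_div, Finset.sum_add_distrib, Finset.sum_boole] at hsum
  simp only [Finset.sum_const, Finset.card_univ, nsmul_eq_mul, mul_one] at hsum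
  linarith

open Classical in
lemma exists_finset_sum_inner_sq_le {z : κ → EuclideanSpace ℝ ι} {q A B : ℝ} (hq : 0 ≤ q)
    (hA : 0 ≤ A) (hB : 0 ≤ B) (h : ∀ y, (#{i | q < |⟪z i, y⟫|} : ℝ) ≤ A + B * ‖y‖ ^ 2) :
    ∃ s : Finset κ, Fintype.card κ - 6 * (A + B) ≤ #s ∧
      ∀ y, ∑ i ∈ s, ⟪z i, y⟫ ^ 2 ≤ 4 * q ^ 2 * Fintype.card κ * ‖y‖ ^ 2 := by
  obtain ⟨w, ⟨hw₀, hw₁⟩, hcard, hw⟩ := exists_weights_forall_sum_mul_inner_sq_le hq hA hB h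
  refine ⟨({i | 1 / 2 ≤ w i} : Finset κ), ?_, fun y ↦ ?_⟩
  · linarith [card_sub_le_card_half_le hw₁ hcard]
  calc ∑ i with 1 / 2 ≤ w i, ⟪z i, y⟫ ^ 2
      ≤ ∑ i with 1 / 2 ≤ w i, 2 * (w i * ⟪z i, y⟫ ^ 2) :=
        Finset.sum_le_sum fun i hi ↦ by
          nlinarith [(Finset.mem_filter.1 hi).2, sq_nonneg ⟪z i, y⟫]
    _ ≤ ∑ i, 2 * (w i * ⟪z i, y⟫ ^ 2) :=
        Finset.sum_le_univ_sum_of_nonneg fun i ↦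
          mul_nonneg zero_le_two (mul_nonneg (hw₀ i) (sq_nonneg _))
    _ = 2 * ∑ i, w i * ⟪z i, y⟫ ^ 2 := by rw [Finset.mul_sum]
    _ ≤ 4 * q ^ 2 * Fintype.card κ * ‖y‖ ^ 2 := by linarith [hw y]

end Selection

section Corruption

variable {E : Type*} {n k : ℕ} {ε : ℝ}

lemma exists_equiv_of_map_univ_eq {α β : Type*} [Fintype α] [Fintype β] {x : α → E} {y : β → E}
    (h : Finset.univ.val.map x = Finset.univ.val.map y) : ∃ e : α ≃ β, ∀ i, y (e i) = x i := by
  classical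
  have hfiber (c : E) : Nonempty ({i // x i = c} ≃ {j // y j = c}) := by
    have hcount := congrArg (Multiset.count c) h
    simp only [Multiset.count_map] at hcount
    rw [← Fintype.card_eq, Fintype.card_subtype, Fintype.card_subtype]
    simpa [Finset.card_def, eq_comm] using hcount
  exact ⟨.ofFiberEquiv fun c ↦ (hfiber c).some, Equiv.ofFiberEquiv_map _⟩

lemma exists_equiv_sum_of_toMultiset_eq_add [DecidableEq E] {x : Fin n → E} {U R : Multiset E}
    (h : toMultiset x = U + R) :
    ∃ e : Fin n ≃ U ⊕ R, ∀ i, Sum.elim (fun u : U ↦ (u : E)) (fun r : R ↦ (r : E)) (e i) = x i := by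
  refine exists_equiv_of_map_univ_eq (h.trans ?_)
  rw [← Finset.univ_disjSum_univ, Finset.val_disjSum, Multiset.disjSum, Multiset.map_add,
    Multiset.map_map, Multiset.map_map, Sum.elim_comp_inl, Sum.elim_comp_inr,
    Multiset.map_univ_coe, Multiset.map_univ_coe]

lemma exists_perm_of_isCorruption [DecidableEq E] {x t : Fin n → E}
    (h : IsCorruption ε (toMultiset x) (toMultiset t)) :
    ∃ ρ : Equiv.Perm (Fin n), (#{i | t i ≠ x (ρ i)} : ℝ) ≤ ε * n := by
  obtain ⟨U, R, A, hx, ht, hAR, hR⟩ := h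
  obtain ⟨e, he⟩ := exists_equiv_sum_of_toMultiset_eq_add hx
  obtain ⟨f, hf⟩ := exists_equiv_sum_of_toMultiset_eq_add ht
  obtain ⟨g⟩ : Nonempty (A ≃ R) := by simpa [← Fintype.card_eq] using hAR
  set ρ := f.trans ((Equiv.sumCongr (.refl _) g).trans e.symm) with hρ
  have hsub : ∀ i, t i ≠ x (ρ i) → ∃ a, f i = .inr a := by
    intro i hi
    rcases hfi : f i with u | a
    · exact absurd (by simp [← hf, ← he, hρ, hfi]) hi
    · exact ⟨a, rfl⟩
  have hcard : #{i | t i ≠ x (ρ i)} ≤ A.card := by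
    rw [← Multiset.card_coe, ← Finset.card_univ, ← Finset.card_map (.inr : A ↪ U ⊕ A)]
    refine Finset.card_le_card_of_injOn f (fun i hi ↦ ?_) f.injective.injOn
    obtain ⟨a, ha⟩ := hsub i (by simpa using hi)
    simp [ha]
  exact ⟨ρ, (Nat.cast_le.2 (hcard.trans hAR.le)).trans (by simpa [toMultiset] using hR)⟩

lemma isCorruption_toMultiset [DecidableEq E] {f g : Fin k → E}
    (h : (#{b | g b ≠ f b} : ℝ) ≤ ε * k) : IsCorruption ε (toMultiset f) (toMultiset g) := by
  have hsplit (w : Fin k → E) : toMultiset w =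
      (Finset.univ.filter fun b ↦ g b = f b).val.map w +
        (Finset.univ.filter fun b ↦ g b ≠ f b).val.map w := by
    rw [← Multiset.map_add, Finset.filter_val, Finset.filter_val, Multiset.filter_add_not,
      toMultiset]
  refine ⟨_, _, (Finset.univ.filter fun b ↦ g b ≠ f b).val.map g, hsplit f, ?_, by simp, ?_⟩
  · rw [hsplit g]
    congr 1
    exact Multiset.map_congr rfl fun b hb ↦ by simpa using hb
  · simpa [toMultiset, Finset.card_def] using h

variable {d : ℕ}

lemma bucket_index_injective : Function.Injective fun p : Fin k × Fin (n / k) ↦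
    (⟨p.1.val * (n / k) + p.2.val, bucket_index_lt p.1 p.2⟩ : Fin n) := by
  have hval : (fun p : Fin k × Fin (n / k) ↦ p.1.val * (n / k) + p.2.val) =
      Fin.val ∘ finProdFinEquiv := by
    ext p
    simp [add_comm, mul_comm]
  have hinj := Fin.val_injective.comp (finProdFinEquiv (m := k) (n := n / k)).injective
  rw [← hval] at hinj
  exact fun p p' h ↦ hinj (by simpa using h)

open Classical in
lemma card_bucketMean_ne_le (v w : Fin n → Vec d) :
    #{b : Fin k | bucketMean k v b ≠ bucketMean k w b} ≤ #{i | v i ≠ w i} := by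
  set idx : Fin k × Fin (n / k) → Fin n := fun p ↦
    ⟨p.1.val * (n / k) + p.2.val, bucket_index_lt p.1 p.2⟩
  have hsub : ({b | bucketMean k v b ≠ bucketMean k w b} : Finset (Fin k)) ⊆
      ({p | v (idx p) ≠ w (idx p)} : Finset (Fin k × Fin (n / k))).image Prod.fst := by
    intro b hb
    contrapose! hb
    have heq (j) : v (idx (b, j)) = w (idx (b, j)) := by
      simpa using mt (Finset.mem_image_of_mem Prod.fst (a := (b, j))) hb
    have hmean : bucketMean k v b = bucketMean k w b :=
      congrArg _ (Finset.sum_congr rfl fun j _ ↦ heq j)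
    simpa using hmean
  calc #{b | bucketMean k v b ≠ bucketMean k w b}
      ≤ #{p | v (idx p) ≠ w (idx p)} := (Finset.card_le_card hsub).trans Finset.card_image_le
    _ ≤ #{i | v i ≠ w i} := Finset.card_le_card_of_injOn idx (fun p hp ↦ by simpa using hp)
        bucket_index_injective.injOn

open Classical in
lemma isCorruption_momPreprocess {x t : Fin n → Vec d} {ρ : Equiv.Perm (Fin n)}
    (h : (#{i | t i ≠ x (ρ i)} : ℝ) ≤ ε * k) (σ : Equiv.Perm (Fin n)) :
    IsCorruption ε (toMultiset (bucketMean k fun i ↦ x (ρ (σ i)))) (momPreprocess k t σ) := by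
  refine isCorruption_toMultiset (le_trans (Nat.cast_le.2 ?_) h)
  refine (card_bucketMean_ne_le (k := k) (fun i ↦ t (σ i)) fun i ↦ x (ρ (σ i))).trans (le_of_eq ?_)
  exact Finset.card_equiv σ (by simp)

end Corruption

section Shuffle

variable {Ω : Type*} [MeasurableSpace Ω] {Pr : Measure Ω}

open Classical in
lemma sum_measure_le_of_card_le {β : Type*} [Fintype β] {s t : β → Set Ω}
    (hs : ∀ b, MeasurableSet (s b)) (ht : ∀ b, MeasurableSet (t b))
    (h : ∀ᵐ ω ∂Pr, #{b | ω ∈ s b} ≤ #{b | ω ∈ t b}) : ∑ b, Pr (s b) ≤ ∑ b, Pr (t b) := by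
  have hsum {u : β → Set Ω} (hu : ∀ b, MeasurableSet (u b)) :
      ∑ b, Pr (u b) = ∫⁻ ω, #{b | ω ∈ u b} ∂Pr := by
    simp_rw [← fun b ↦ lintegral_indicator_one (μ := Pr) (hu b)]
    rw [← lintegral_finsetSum _ fun b _ ↦ measurable_one.indicator (hu b)]
    simp [Set.indicator_apply]
  rw [hsum hs, hsum ht]
  exact lintegral_mono_ae (h.mono fun ω hω ↦ Nat.cast_le.2 hω)

lemma measure_mem_eq_average_of_indepFun {α β : Type*} [MeasurableSpace α] [MeasurableSpace β]
    [Fintype β] [MeasurableSingletonClass β] {V : Ω → α} {π : Ω → β} (hV : Measurable V)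
    (hπ : Measurable π) (hunif : HasLaw π (uniformOn Set.univ) Pr) (hind : IndepFun π V Pr)
    {bad : β → Set α} (hbad : ∀ b, MeasurableSet (bad b)) :
    Pr {ω | V ω ∈ bad (π ω)} = (Fintype.card β : ℝ≥0∞)⁻¹ * ∑ b, Pr (V ⁻¹' bad b) := by
  have hunion : {ω | V ω ∈ bad (π ω)} = ⋃ b, π ⁻¹' {b} ∩ V ⁻¹' bad b := by
    ext ω
    simp
  have hmass (b : β) : Pr (π ⁻¹' {b}) = (Fintype.card β : ℝ≥0∞)⁻¹ := by
    rw [← Measure.map_apply hπ (measurableSet_singleton b), hunif.map_eq, uniformOn_univ,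
      Measure.count_singleton, one_div]
  rw [hunion, measure_iUnion (fun b c hbc ↦ ?_)
    fun b ↦ (hπ (measurableSet_singleton b)).inter (hV (hbad b)), tsum_fintype, Finset.mul_sum]
  · refine Finset.sum_congr rfl fun b _ ↦ ?_
    rw [hind.measure_inter_preimage_eq_mul _ _ (measurableSet_singleton b) (hbad b), hmass]
  · exact (Disjoint.preimage π (Set.disjoint_singleton.2 hbc)).mono Set.inter_subset_left
      Set.inter_subset_left

variable {F : Type*} [MeasurableSpace F] {P : Measure F} {n : ℕ}

lemma map_comp_eq_pi {ι κ : Type*} [Fintype κ] {X : ι → Ω → F} (hlaw : ∀ i, HasLaw (X i) P Pr)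
    (hind : iIndepFun X Pr) {g : κ → ι} (hg : g.Injective) :
    Pr.map (fun ω j ↦ X (g j) ω) = Measure.pi fun _ ↦ P := by
  have := hind.isProbabilityMeasure
  rw [(iIndepFun_iff_map_fun_eq_pi_map fun j ↦ (hlaw (g j)).aemeasurable).1 (hind.precomp hg)]
  simp_rw [(hlaw _).map_eq]

open Classical in
/-- The shuffle makes the probability of a data-dependent bad set of permutations an average over
all permutations, so that only the number of bad permutations matters. -/
lemma measure_shuffle_le {α : Type*} [MeasurableSpace α] {X : Fin n → Ω → F}
    {π : Ω → Equiv.Perm (Fin n)} {V : Ω → α}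
    (hX : ∀ i, Measurable (X i)) (hlaw : ∀ i, HasLaw (X i) P Pr) (hind : iIndepFun X Pr)
    (hπ : Measurable π) (hunif : HasLaw π (uniformOn Set.univ) Pr) (hV : Measurable V)
    (hπV : IndepFun π V Pr) {bad : Equiv.Perm (Fin n) → Set α} (hbad : ∀ p, MeasurableSet (bad p))
    {B : Set (Fin n → F)} (hB : MeasurableSet B)
    (hcount : ∀ᵐ ω ∂Pr, #{p | V ω ∈ bad p} ≤ #{p : Equiv.Perm (Fin n) | (X · ω) ∘ p ∈ B}) :
    Pr {ω | V ω ∈ bad (π ω)} ≤ Measure.pi (fun _ ↦ P) B := by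
  have hmeas (p : Equiv.Perm (Fin n)) : Measurable fun ω ↦ (X · ω) ∘ p :=
    measurable_pi_lambda _ fun i ↦ hX (p i)
  have hexch (p : Equiv.Perm (Fin n)) : Pr {ω | (X · ω) ∘ p ∈ B} = Measure.pi (fun _ ↦ P) B := by
    rw [← map_comp_eq_pi hlaw hind p.injective]
    exact (Measure.map_apply (hmeas p) hB).symm
  rw [measure_mem_eq_average_of_indepFun hV hπ hunif hπV hbad]
  calc (Fintype.card (Equiv.Perm (Fin n)) : ℝ≥0∞)⁻¹ * ∑ p, Pr (V ⁻¹' bad p)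
      ≤ (Fintype.card (Equiv.Perm (Fin n)) : ℝ≥0∞)⁻¹ *
          ∑ p : Equiv.Perm (Fin n), Pr {ω | (X · ω) ∘ p ∈ B} := by
        gcongr _ * ?_
        exact sum_measure_le_of_card_le (fun p ↦ hV (hbad p)) (fun p ↦ hmeas p hB) hcount
    _ = Measure.pi (fun _ ↦ P) B := by
        simp_rw [hexch]
        rw [Finset.sum_const, nsmul_eq_mul, ← mul_assoc, Finset.card_univ,
          ENNReal.inv_mul_cancel (by simp [Fintype.card_ne_zero]) (by simp), one_mul]

variable {d k : ℕ}

lemma measurableSet_card_ne_le {E : Type*} [DecidableEq E] [MeasurableSpace E] [MeasurableEq E]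
    (ρ : Fin n → Fin n) (c : ℝ) :
    MeasurableSet {v : (Fin n → E) × (Fin n → E) | (#{i | v.2 i ≠ v.1 (ρ i)} : ℝ) ≤ c} := by
  refine measurableSet_le ?_ measurable_const
  simp_rw [Finset.card_filter]
  push_cast
  refine Finset.measurable_sum _ fun i _ ↦ Measurable.ite ?_ measurable_const measurable_const
  exact (measurableSet_eq_fun (by fun_prop) (by fun_prop)).compl

lemma measure_corrupted_le {P : Measure (Vec d)}
    {X : Fin n → Ω → Vec d} {T : Ω → Fin n → Vec d} {π : Ω → Equiv.Perm (Fin n)} {ε η : ℝ}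
    (hX : ∀ i, Measurable (X i)) (hlaw : ∀ i, HasLaw (X i) P Pr) (hind : iIndepFun X Pr)
    (hT : Measurable T)
    (hcor : ∀ᵐ ω ∂Pr, IsCorruption ε (toMultiset fun i ↦ X i ω) (toMultiset (T ω)))
    (hπ : Measurable π) (hunif : HasLaw π (uniformOn Set.univ) Pr)
    (hπV : IndepFun π (fun ω ↦ ((fun i ↦ X i ω), T ω)) Pr) (hε : ε * n ≤ η * k)
    (good : Multiset (Vec d) → Prop) :
    Pr {ω | ¬ ∃ S, IsCorruption η S (momPreprocess k (T ω) (π ω)) ∧ good S} ≤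
      Measure.pi (fun _ ↦ P) {x : Fin n → Vec d | ¬ good (toMultiset (bucketMean k x))} := by
  classical
  set B := toMeasurable (Measure.pi fun _ ↦ P)
    {x : Fin n → Vec d | ¬ good (toMultiset (bucketMean k x))} with hBdef
  have hB : MeasurableSet B := measurableSet_toMeasurable _ _
  -- `p` is bad if every way of matching the corrupted sample with the clean one leads into `B`.
  set bad : Equiv.Perm (Fin n) → Set ((Fin n → Vec d) × (Fin n → Vec d)) := fun p ↦
    ⋂ ρ : Equiv.Perm (Fin n),
      {v | (#{i | v.2 i ≠ v.1 (ρ i)} : ℝ) ≤ ε * n}ᶜ ∪ {v | v.1 ∘ ρ ∘ p ∈ B} with hbad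
  have hbadm (p) : MeasurableSet (bad p) := by
    have hcomp (ρ : Equiv.Perm (Fin n)) : Measurable fun v : (Fin n → Vec d) × (Fin n → Vec d) ↦
        v.1 ∘ ρ ∘ p := measurable_pi_lambda _ fun i ↦ by fun_prop
    exact MeasurableSet.iInter fun ρ ↦
      (measurableSet_card_ne_le ρ _).compl.union (hcomp ρ hB)
  have hshuffle := measure_shuffle_le hX hlaw hind hπ hunif (by fun_prop) hπV hbadm hB
    (hcor.mono fun ω hω ↦ by
      obtain ⟨ρ, hρ⟩ := exists_perm_of_isCorruption hω
      refine Finset.card_le_card_of_injOn (·.trans ρ) (fun p hp ↦ ?_) fun p _ p' _ h ↦ ?_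
      · simp only [Finset.coe_filter, Finset.mem_univ, true_and, Set.mem_ofPred_eq, hbad,
          Set.mem_iInter, Set.mem_union, Set.mem_compl_iff] at hp ⊢
        exact (hp ρ).resolve_left (not_not.2 hρ)
      · exact Equiv.ext fun i ↦ ρ.injective (DFunLike.congr_fun h i))
  rw [hBdef, measure_toMeasurable] at hshuffle
  refine (measure_mono fun ω hω ↦ ?_).trans hshuffle
  simp only [hbad, Set.mem_ofPred_eq, Set.mem_iInter, Set.mem_union, Set.mem_compl_iff] at hω ⊢
  refine fun ρ ↦ or_iff_not_imp_left.2 fun hρ ↦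
    subset_toMeasurable _ _ fun hgood ↦ hω ⟨_, ?_, hgood⟩
  exact isCorruption_momPreprocess (x := fun i ↦ X i ω) ((not_not.1 hρ).trans hε) (π ω)

end Shuffle

section QuadraticForm

variable {ι E : Type*} [Fintype ι] [NormedAddCommGroup E] [InnerProductSpace ℝ E]

lemma bilin_apply_eq_sum (b : OrthonormalBasis ι ℝ E) (B : E →L[ℝ] E →L[ℝ] ℝ) (x y : E) :
    B x y = ∑ i, ∑ j, ⟪b i, x⟫ * ⟪b j, y⟫ * B (b i) (b j) := by
  conv_lhs => rw [← b.sum_repr' x, ← b.sum_repr' y]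
  simp only [map_sum, sum_apply, map_smul, smul_apply, smul_eq_mul, Finset.mul_sum, mul_assoc]
  exact (Finset.sum_congr rfl fun j _ ↦ Finset.sum_congr rfl fun i _ ↦ mul_left_comm _ _ _).trans
    Finset.sum_comm

lemma bilin_add_self (B : E →L[ℝ] E →L[ℝ] ℝ) (u x : E) :
    B (u + x) (u + x) = B u u + ((B u + B.flip u) x + B x x) := by
  simp only [map_add, add_apply, ContinuousLinearMap.flip_apply]
  ring

variable [FiniteDimensional ℝ E] [MeasurableSpace E] [BorelSpace E]

lemma integrable_inner_mul_inner_stdGaussian (u v : E) :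
    Integrable (fun x ↦ ⟪u, x⟫ * ⟪v, x⟫) (stdGaussian E) :=
  have hL2 (w : E) : MemLp (fun x ↦ ⟪w, x⟫) 2 (stdGaussian E) :=
    IsGaussian.memLp_dual (stdGaussian E) (innerSL ℝ w) 2 (by simp)
  (hL2 u).integrable_mul (hL2 v)

lemma integral_inner_mul_inner_stdGaussian (u v : E) :
    ∫ x, ⟪u, x⟫ * ⟪v, x⟫ ∂stdGaussian E = ⟪u, v⟫ := by
  have h := covarianceBilin_apply (μ := stdGaussian E) IsGaussian.memLp_two_id u v
  rw [covarianceBilin_stdGaussian, innerSL_apply_apply ℝ] at h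
  simpa [integral_id_stdGaussian] using h.symm

lemma integrable_bilin_stdGaussian (B : E →L[ℝ] E →L[ℝ] ℝ) :
    Integrable (fun x ↦ B x x) (stdGaussian E) := by
  simp_rw [fun x ↦ bilin_apply_eq_sum (stdOrthonormalBasis ℝ E) B x x]
  exact integrable_finsetSum _ fun i _ ↦ integrable_finsetSum _ fun j _ ↦
    (integrable_inner_mul_inner_stdGaussian _ _).mul_const _

lemma integral_bilin_stdGaussian (b : OrthonormalBasis ι ℝ E) (B : E →L[ℝ] E →L[ℝ] ℝ) :
    ∫ x, B x x ∂stdGaussian E = ∑ i, B (b i) (b i) := by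
  classical
  have hint (i j) : Integrable (fun x ↦ ⟪b i, x⟫ * ⟪b j, x⟫ * B (b i) (b j)) (stdGaussian E) :=
    (integrable_inner_mul_inner_stdGaussian _ _).mul_const _
  simp_rw [fun x ↦ bilin_apply_eq_sum b B x x]
  rw [integral_finsetSum _ fun i _ ↦ integrable_finsetSum _ fun j _ ↦ hint i j]
  refine Finset.sum_congr rfl fun i _ ↦ ?_
  rw [integral_finsetSum _ fun j _ ↦ hint i j]
  simp [integral_mul_const, integral_inner_mul_inner_stdGaussian,
    orthonormal_iff_ite.1 b.orthonormal]

lemma integrable_bilin_add_left_stdGaussian (B : E →L[ℝ] E →L[ℝ] ℝ) (u : E) :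
    Integrable (fun x ↦ B (u + x) (u + x)) (stdGaussian E) := by
  simp_rw [bilin_add_self]
  exact (integrable_const _).add
    ((IsGaussian.integrable_dual _ _).add (integrable_bilin_stdGaussian B))

lemma integral_bilin_add_left_stdGaussian (b : OrthonormalBasis ι ℝ E) (B : E →L[ℝ] E →L[ℝ] ℝ)
    (u : E) : ∫ x, B (u + x) (u + x) ∂stdGaussian E = B u u + ∑ i, B (b i) (b i) := by
  have hlin := IsGaussian.integrable_dual (stdGaussian E) (B u + B.flip u)
  have hquad := integrable_bilin_stdGaussian B
  simp_rw [bilin_add_self]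
  rw [integral_add (integrable_const _) (hlin.fun_add hquad), integral_add hlin hquad,
    integral_strongDual_stdGaussian, integral_bilin_stdGaussian b]
  simp

end QuadraticForm

section CovarianceMatrix

variable {d : ℕ} {P : Measure (Vec d)} [IsFiniteMeasure P]

lemma covMat_apply (hP : MemLp id 2 P) (i j : Fin d) :
    covMat P i j = covarianceBilin P (EuclideanSpace.basisFun (Fin d) ℝ i)
      (EuclideanSpace.basisFun (Fin d) ℝ j) := by
  rw [covarianceBilin_apply_eq_cov hP]
  simp [covMat, EuclideanSpace.inner_single_left]

lemma trace_covMat (hP : MemLp id 2 P) : (covMat P).trace = ∑ i,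
    covarianceBilin P (EuclideanSpace.basisFun (Fin d) ℝ i)
      (EuclideanSpace.basisFun (Fin d) ℝ i) :=
  Finset.sum_congr rfl fun i _ ↦ covMat_apply hP i i

lemma trace_covMat_nonneg (hP : MemLp id 2 P) : 0 ≤ (covMat P).trace := by
  rw [trace_covMat hP]
  exact Finset.sum_nonneg fun i _ ↦ covarianceBilin_self_nonneg _

lemma covarianceBilin_eq_inner_covMat (hP : MemLp id 2 P) (u v : Vec d) :
    covarianceBilin P u v =
      ⟪u, Matrix.toEuclideanCLM (n := Fin d) (𝕜 := ℝ) (covMat P) v⟫ := by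
  rw [bilin_apply_eq_sum (EuclideanSpace.basisFun (Fin d) ℝ), Matrix.inner_toEuclideanCLM]
  simp only [← covMat_apply hP, dotProduct, Matrix.mulVec, Finset.mul_sum]
  refine Finset.sum_congr rfl fun i _ ↦ Finset.sum_congr rfl fun j _ ↦ ?_
  simp only [EuclideanSpace.basisFun_apply, EuclideanSpace.inner_single_left, map_one, one_mul]
  ring

lemma specNorm_nonneg (M : Matrix (Fin d) (Fin d) ℝ) : 0 ≤ specNorm M := norm_nonneg _

lemma covarianceBilin_self_le (hP : MemLp id 2 P) (u : Vec d) :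
    covarianceBilin P u u ≤ specNorm (covMat P) * ‖u‖ ^ 2 :=
  calc covarianceBilin P u u
      ≤ ‖u‖ * ‖Matrix.toEuclideanCLM (n := Fin d) (𝕜 := ℝ) (covMat P) u‖ :=
        (covarianceBilin_eq_inner_covMat hP u u).trans_le (real_inner_le_norm _ _)
    _ ≤ ‖u‖ * (specNorm (covMat P) * ‖u‖) := by
        gcongr
        exact ContinuousLinearMap.le_opNorm _ _
    _ = specNorm (covMat P) * ‖u‖ ^ 2 := by ring

end CovarianceMatrix

section Averages

variable {Ω : Type*} [MeasurableSpace Ω] {μ : Measure Ω}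

lemma measureReal_lt_abs_sub_integral_le [IsFiniteMeasure μ] {X : Ω → ℝ} (hX : MemLp X 2 μ) {q : ℝ}
    (hq : 0 ≤ q) (hq₀ : q = 0 → Var[X; μ] = 0) :
    μ.real {ω | q < |X ω - μ[X]|} ≤ Var[X; μ] / q ^ 2 := by
  rcases hq.eq_or_lt with rfl | hpos
  · have hconst := ae_eq_integral_of_variance_eq_zero hX (hq₀ rfl)
    have hnull : μ {ω | 0 < |X ω - μ[X]|} = 0 := by
      simpa only [abs_pos, sub_ne_zero] using ae_iff.1 hconst
    rw [measureReal_def, hnull]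
    simp
  · calc μ.real {ω | q < |X ω - μ[X]|} ≤ μ.real {ω | q ≤ |X ω - μ[X]|} :=
          measureReal_mono fun ω (hω : q < _) ↦ hω.le
      _ ≤ Var[X; μ] / q ^ 2 := ENNReal.toReal_le_of_le_ofReal
          (div_nonneg (variance_nonneg _ _) (sq_nonneg q)) (meas_ge_le_variance_div_sq hX hpos)

lemma variance_average {κ : Type*} [Fintype κ] {Y : κ → Ω → ℝ} {v : ℝ}
    (hY : ∀ j, MemLp (Y j) 2 μ) (hind : iIndepFun Y μ) (hv : ∀ j, Var[Y j; μ] = v) :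
    Var[fun ω ↦ (Fintype.card κ : ℝ)⁻¹ * ∑ j, Y j ω; μ] = v / Fintype.card κ := by
  simp_rw [variance_const_mul, ← Finset.sum_apply]
  rw [IndepFun.variance_sum (fun j _ ↦ hY j) fun i _ j _ hij ↦ hind.indepFun hij]
  simp only [hv, Finset.sum_const, Finset.card_univ, nsmul_eq_mul]
  rcases eq_or_ne (Fintype.card κ : ℝ) 0 with h | h
  · simp [h]
  · field_simp

lemma integral_average {κ : Type*} [Fintype κ] [Nonempty κ] {Y : κ → Ω → ℝ} {e : ℝ}
    (hY : ∀ j, Integrable (Y j) μ) (he : ∀ j, ∫ ω, Y j ω ∂μ = e) :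
    ∫ ω, (Fintype.card κ : ℝ)⁻¹ * ∑ j, Y j ω ∂μ = e := by
  rw [integral_const_mul, integral_finsetSum _ fun j _ ↦ hY j]
  simp [he]

lemma iIndepFun_curry {ι κ F : Type*} [MeasurableSpace F] {X : ι × κ → Ω → F}
    (hX : ∀ p, Measurable (X p)) (h : iIndepFun X μ) :
    iIndepFun (fun i ω j ↦ X (i, j) ω) μ := by
  have := h.isProbabilityMeasure
  have hprob : ∀ i j, IsProbabilityMeasure (μ.map (X (i, j))) := fun i j ↦
    Measure.isProbabilityMeasure_map (hX _).aemeasurable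
  have hcomp : MeasurableEquiv.curry ι κ F ∘ (fun ω p ↦ X p ω) = fun ω i j ↦ X (i, j) ω := by
    ext; simp
  rw [iIndepFun_iff_map_fun_eq_infinitePi_map (by fun_prop), ← hcomp,
    ← Measure.map_map (by fun_prop) (by fun_prop),
    (iIndepFun_iff_map_fun_eq_infinitePi_map (by fun_prop)).1 h,
    Measure.infinitePi_map_curry fun i j ↦ μ.map (X (i, j))]
  congr 1 with i : 1
  exact ((iIndepFun_iff_map_fun_eq_infinitePi_map (by fun_prop)).1
    (h.precomp (Prod.mk_right_injective i))).symm

end Averages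

section Buckets

variable {d n k : ℕ} {P : Measure (Vec d)} [IsProbabilityMeasure P]

lemma measurable_bucketMean (b : Fin k) :
    Measurable fun x : Fin n → Vec d ↦ bucketMean k x b := by
  unfold bucketMean
  fun_prop

lemma iIndepFun_eval_pi : iIndepFun (fun (i : Fin n) (x : Fin n → Vec d) ↦ x i)
    (Measure.pi fun _ ↦ P) :=
  iIndepFun_pi (X := fun _ ↦ id) fun _ ↦ aemeasurable_id

lemma iIndepFun_bucketMean :
    iIndepFun (fun (b : Fin k) (x : Fin n → Vec d) ↦ bucketMean k x b)
      (Measure.pi fun _ ↦ P) :=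
  (iIndepFun_curry
    (X := fun (p : Fin k × Fin (n / k)) (x : Fin n → Vec d) ↦
      x ⟨p.1.val * (n / k) + p.2.val, bucket_index_lt p.1 p.2⟩)
    (by fun_prop) (iIndepFun_eval_pi.precomp bucket_index_injective)).comp
    (fun _ y ↦ ((n / k : ℕ) : ℝ)⁻¹ • ∑ j, y j) fun _ ↦ by fun_prop

lemma inner_bucketMean (θ : Vec d) (x : Fin n → Vec d) (b : Fin k) :
    ⟪θ, bucketMean k x b⟫ = (Fintype.card (Fin (n / k)) : ℝ)⁻¹ *
      ∑ j : Fin (n / k), ⟪θ, x ⟨b.val * (n / k) + j.val, bucket_index_lt b j⟩⟫ := by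
  rw [bucketMean, real_inner_smul_right, inner_sum, Fintype.card_fin]

lemma memLp_inner_eval_pi (hP : MemLp id 2 P) (θ : Vec d) (i : Fin n) :
    MemLp (fun x : Fin n → Vec d ↦ ⟪θ, x i⟫) 2 (Measure.pi fun _ ↦ P) :=
  (hP.const_inner (𝕜 := ℝ) θ).comp_measurePreserving (measurePreserving_eval _ i)

lemma memLp_inner_bucketMean (hP : MemLp id 2 P) (θ : Vec d) (b : Fin k) :
    MemLp (fun x : Fin n → Vec d ↦ ⟪θ, bucketMean k x b⟫) 2 (Measure.pi fun _ ↦ P) := by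
  simp_rw [inner_bucketMean]
  exact (memLp_finsetSum _ fun j _ ↦ memLp_inner_eval_pi hP θ _).const_mul _

lemma integral_inner_bucketMean (hP : MemLp id 2 P) (hm : 0 < n / k) (θ : Vec d) (b : Fin k) :
    ∫ x : Fin n → Vec d, ⟪θ, bucketMean k x b⟫ ∂Measure.pi (fun _ ↦ P) = ⟪θ, ∫ x, x ∂P⟫ := by
  have : Nonempty (Fin (n / k)) := ⟨0, hm⟩
  simp_rw [inner_bucketMean]
  refine integral_average (fun j ↦ (memLp_inner_eval_pi hP θ _).integrable (by simp)) fun j ↦ ?_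
  exact ((measurePreserving_eval _ _).hasLaw.integral_comp (by fun_prop)).trans
    (integral_inner (hP.integrable (by simp)) θ)

lemma variance_inner_bucketMean (hP : MemLp id 2 P) (θ : Vec d) (b : Fin k) :
    Var[fun x : Fin n → Vec d ↦ ⟪θ, bucketMean k x b⟫; Measure.pi fun _ ↦ P] =
      covarianceBilin P θ θ / (n / k : ℕ) := by
  set idx : Fin (n / k) → Fin n := fun j ↦ ⟨b.val * (n / k) + j.val, bucket_index_lt b j⟩
  have hidx : idx.Injective := bucket_index_injective.comp (Prod.mk_right_injective b)
  have hvar (i : Fin n) : Var[fun x : Fin n → Vec d ↦ ⟪θ, x i⟫; Measure.pi fun _ ↦ P] =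
      covarianceBilin P θ θ := by
    rw [covarianceBilin_self hP]
    exact (measurePreserving_eval _ i).variance_fun_comp (by fun_prop)
  simp_rw [inner_bucketMean]
  rw [variance_average (fun j ↦ memLp_inner_eval_pi hP θ (idx j))
    ((iIndepFun_eval_pi.precomp hidx).comp (fun _ y ↦ ⟪θ, y⟫) fun _ ↦ by fun_prop)
    fun j ↦ hvar (idx j), Fintype.card_fin]

lemma measureReal_lt_abs_inner_bucketMean_le (hP : MemLp id 2 P) (hm : 0 < n / k) (θ : Vec d)
    (b : Fin k) {q : ℝ} (hq : 0 ≤ q) (hq₀ : q = 0 → covarianceBilin P θ θ = 0) :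
    (Measure.pi fun _ : Fin n ↦ P).real {x | q < |⟪θ, bucketMean k x b - ∫ x, x ∂P⟫|} ≤
      covarianceBilin P θ θ / ((n / k : ℕ) * q ^ 2) := by
  have hcheb := measureReal_lt_abs_sub_integral_le (memLp_inner_bucketMean (n := n) hP θ b) hq
    fun h ↦ by
    rw [variance_inner_bucketMean hP, hq₀ h, zero_div]
  simpa only [inner_sub_right, variance_inner_bucketMean hP, integral_inner_bucketMean hP hm,
    div_div] using hcheb

lemma integral_measureReal_lt_abs_inner_bucketMean_le (hP : MemLp id 2 P) (hm : 0 < n / k)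
    (u : Vec d) (b : Fin k) {q : ℝ} (hq : 0 ≤ q) (hq₀ : q = 0 → specNorm (covMat P) = 0) :
    ∫ θ, (Measure.pi fun _ : Fin n ↦ P).real
        {x | q < |⟪u + θ, bucketMean k x b - ∫ x, x ∂P⟫|} ∂stdGaussian (Vec d) ≤
      (specNorm (covMat P) * ‖u‖ ^ 2 + (covMat P).trace) / ((n / k : ℕ) * q ^ 2) := by
  have hzero (h : q = 0) (θ : Vec d) : covarianceBilin P θ θ = 0 :=
    le_antisymm (by simpa [hq₀ h] using covarianceBilin_self_le hP θ)
      (covarianceBilin_self_nonneg θ)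
  calc ∫ θ, (Measure.pi fun _ : Fin n ↦ P).real
        {x | q < |⟪u + θ, bucketMean k x b - ∫ x, x ∂P⟫|} ∂stdGaussian (Vec d)
      ≤ ∫ θ, covarianceBilin P (u + θ) (u + θ) / ((n / k : ℕ) * q ^ 2) ∂stdGaussian (Vec d) :=
        integral_mono_of_nonneg (.of_forall fun _ ↦ measureReal_nonneg)
          ((integrable_bilin_add_left_stdGaussian _ _).div_const _) (.of_forall fun θ ↦
            measureReal_lt_abs_inner_bucketMean_le hP hm (u + θ) b hq fun h ↦ hzero h _)
    _ = (covarianceBilin P u u + (covMat P).trace) / ((n / k : ℕ) * q ^ 2) := by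
        rw [integral_div, integral_bilin_add_left_stdGaussian (EuclideanSpace.basisFun (Fin d) ℝ),
          trace_covMat hP]
    _ ≤ (specNorm (covMat P) * ‖u‖ ^ 2 + (covMat P).trace) / ((n / k : ℕ) * q ^ 2) := by
        gcongr
        exact covarianceBilin_self_le hP u

open Classical in
/-- Applying the counting bound to the direction `√β • y` trades the Gaussian cost `‖y‖² / 2` for a
small multiple of `‖y‖²`. -/
lemma measure_card_large_bucketMean_le (hP : MemLp id 2 P) (hm : 0 < n / k) {q β : ℝ}
    (hq : 0 ≤ q) (hβ : 0 < β) (hq₀ : q = 0 → specNorm (covMat P) = 0) (t : ℝ) :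
    (Measure.pi fun _ : Fin n ↦ P) {x | ¬ ∀ y : Vec d,
      (#{b : Fin k | q < |⟪bucketMean k x b - ∫ x, x ∂P, y⟫|} : ℝ) ≤
        (2 * t + 4 * k * ((covMat P).trace / (β * ((n / k : ℕ) * q ^ 2)))) +
        (β + 4 * k * (specNorm (covMat P) / ((n / k : ℕ) * q ^ 2))) * ‖y‖ ^ 2} ≤
      ENNReal.ofReal (Real.exp (-t)) := by
  have hsqrt : 0 < √β := Real.sqrt_pos.2 hβ
  refine (measure_mono fun x hx ↦ ?_).trans (measure_exists_lt_card_lt_abs_inner_le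
    (Z := fun (b : Fin k) (x : Fin n → Vec d) ↦ bucketMean k x b - ∫ x, x ∂P)
    (fun b ↦ (measurable_bucketMean b).sub_const _)
    (iIndepFun_bucketMean.comp (fun _ y ↦ y - ∫ x, x ∂P) fun _ ↦ by fun_prop) (√β * q) t)
  simp only [Set.mem_ofPred_eq, not_forall, not_le] at hx ⊢
  obtain ⟨y, hy⟩ := hx
  refine ⟨√β • y, ?_⟩
  have hscale (b : Fin k) : √β * q < |⟪√β • y, bucketMean k x b - ∫ x, x ∂P⟫| ↔
      q < |⟪bucketMean k x b - ∫ x, x ∂P, y⟫| := by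
    rw [real_inner_smul_left, abs_mul, abs_of_pos hsqrt, mul_lt_mul_iff_right₀ hsqrt,
      real_inner_comm]
  have hnorm : ‖√β • y‖ ^ 2 = β * ‖y‖ ^ 2 := by
    rw [norm_smul, mul_pow, Real.norm_eq_abs, sq_abs, Real.sq_sqrt hβ.le]
  have hprob := Finset.sum_le_card_nsmul Finset.univ _ _ fun (b : Fin k) _ ↦
    integral_measureReal_lt_abs_inner_bucketMean_le (n := n) hP hm (√β • y) b (q := √β * q)
      (by positivity) fun h ↦ hq₀ (by simpa [hsqrt.ne'] using h)
  have hsplit : (specNorm (covMat P) * (β * ‖y‖ ^ 2) + (covMat P).trace) /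
      ((n / k : ℕ) * (√β * q) ^ 2) =
      specNorm (covMat P) / ((n / k : ℕ) * q ^ 2) * ‖y‖ ^ 2 +
        (covMat P).trace / (β * ((n / k : ℕ) * q ^ 2)) := by
    rw [mul_pow, Real.sq_sqrt hβ.le, mul_left_comm _ β, add_div, mul_left_comm _ β,
      mul_div_mul_left _ _ hβ.ne', mul_div_right_comm]
  simp only [hscale]
  rw [Finset.card_univ, Fintype.card_fin, nsmul_eq_mul, hnorm, hsplit] at hprob
  rw [hnorm]
  refine lt_of_le_of_lt ?_ hy
  linarith

end Buckets

section Stability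

variable {α : Type*}

lemma sum_map_le_sum_map_of_le {R S : Multiset α} (h : R ≤ S) {f : α → ℝ} (hf : ∀ x, 0 ≤ f x) :
    (R.map f).sum ≤ (S.map f).sum := by
  obtain ⟨T, rfl⟩ := Multiset.le_iff_exists_add.1 h
  rw [Multiset.map_add, Multiset.sum_add]
  exact le_add_of_nonneg_right (Multiset.sum_nonneg (by simpa using fun x _ ↦ hf x))

lemma sq_sum_map_le_card_mul_sum_map_sq (R : Multiset α) (f : α → ℝ) :
    (R.map f).sum ^ 2 ≤ R.card * (R.map fun x ↦ f x ^ 2).sum := by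
  classical
  have h := sq_sum_le_card_mul_sum_sq (s := Finset.univ) (f := fun x : R ↦ f x)
  rwa [Finset.card_univ, Multiset.card_coe, Finset.sum, Finset.sum, Multiset.map_univ,
    Multiset.map_univ (f := fun x ↦ f x ^ 2)] at h

variable {d : ℕ} {R S : Multiset (Vec d)} {μ : Vec d}

lemma inner_msMean_sub (hR : R ≠ 0) (μ y : Vec d) :
    ⟪msMean R - μ, y⟫ = (R.card : ℝ)⁻¹ * (R.map fun x ↦ ⟪x - μ, y⟫).sum := by
  have hcard : (R.card : ℝ) ≠ 0 := by simpa using hR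
  have hsum : ⟪R.sum, y⟫ = (R.map fun x ↦ ⟪x, y⟫).sum :=
    map_multiset_sum ((innerₗ (Vec d)).flip y) R
  simp only [msMean, inner_sub_left, real_inner_smul_left, hsum, Multiset.sum_map_sub,
    Multiset.map_const', Multiset.sum_replicate, nsmul_eq_mul]
  field_simp

lemma inner_secondMoment (R : Multiset (Vec d)) (μ y z : Vec d) :
    ⟪y, Matrix.toEuclideanCLM (n := Fin d) (𝕜 := ℝ) (secondMoment μ R) z⟫ =
      (R.card : ℝ)⁻¹ * (R.map fun x ↦ ⟪x - μ, y⟫ * ⟪x - μ, z⟫).sum := by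
  rw [secondMoment, Matrix.inner_toEuclideanCLM, Matrix.smul_mulVec, dotProduct_smul, smul_eq_mul]
  congr 1
  induction R using Multiset.induction_on with
  | empty => simp
  | cons a R ih =>
    simp only [Multiset.map_cons, Multiset.sum_cons, Matrix.add_mulVec, dotProduct_add, ih,
      Matrix.vecMulVec_mulVec, dotProduct_smul]
    simp [EuclideanSpace.inner_eq_star_dotProduct, dotProduct_comm]

lemma norm_msMean_sub_sq_le (hR : R ≠ 0) (μ : Vec d) :
    ‖msMean R - μ‖ ^ 2 ≤ specNorm (secondMoment μ R) := by
  set w := msMean R - μ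
  have hcard : (0 : ℝ) < R.card := by simpa [Multiset.card_pos] using hR
  have hmean : R.card * ‖w‖ ^ 2 = (R.map fun x ↦ ⟪x - μ, w⟫).sum := by
    rw [← real_inner_self_eq_norm_sq, inner_msMean_sub hR, mul_inv_cancel_left₀ hcard.ne']
  have hcov : (R.map fun x ↦ ⟪x - μ, w⟫ ^ 2).sum ≤
      R.card * (specNorm (secondMoment μ R) * ‖w‖ ^ 2) := by
    rw [← inv_mul_le_iff₀ hcard]
    simp only [sq ⟪_, _⟫, ← inner_secondMoment]
    calc _ ≤ ‖w‖ * (specNorm (secondMoment μ R) * ‖w‖) := by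
          grw [real_inner_le_norm, ContinuousLinearMap.le_opNorm]
          rfl
      _ = specNorm (secondMoment μ R) * ‖w‖ ^ 2 := by ring
  have hcs := sq_sum_map_le_card_mul_sum_map_sq R fun x ↦ ⟪x - μ, w⟫
  rcases (norm_nonneg w).eq_or_lt' with hw | hw
  · rw [hw, zero_pow two_ne_zero]
    exact specNorm_nonneg _
  · rw [← hmean] at hcs
    refine le_of_mul_le_mul_right ?_ (by positivity : 0 < (R.card * ‖w‖) ^ 2)
    nlinarith

lemma specNorm_secondMoment_le {G : ℝ} (hG : 0 ≤ G)
    (h : ∀ y, (R.map fun x ↦ ⟪x - μ, y⟫ ^ 2).sum ≤ G * R.card * ‖y‖ ^ 2) :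
    specNorm (secondMoment μ R) ≤ G := by
  refine ContinuousLinearMap.opNorm_le_of_re_inner_le hG fun y z hy hz ↦ ?_
  rw [real_inner_comm, RCLike.re_to_real, inner_secondMoment]
  have hsum : (R.map fun x ↦ ⟪x - μ, z⟫ * ⟪x - μ, y⟫).sum ≤ R.card * G :=
    calc (R.map fun x ↦ ⟪x - μ, z⟫ * ⟪x - μ, y⟫).sum
        ≤ (R.map fun x ↦ (⟪x - μ, z⟫ ^ 2 + ⟪x - μ, y⟫ ^ 2) / 2).sum :=
          Multiset.sum_map_le_sum_map _ _ fun x _ ↦ by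
            linarith [two_mul_le_add_sq ⟪x - μ, z⟫ ⟪x - μ, y⟫]
      _ = ((R.map fun x ↦ ⟪x - μ, z⟫ ^ 2).sum + (R.map fun x ↦ ⟪x - μ, y⟫ ^ 2).sum) / 2 := by
          rw [Multiset.sum_map_div, Multiset.sum_map_add]
      _ ≤ R.card * G := by
          have hz' := h z
          have hy' := h y
          rw [hz, one_pow, mul_one] at hz'
          rw [hy, one_pow, mul_one] at hy'
          linarith
  exact inv_mul_le_of_le_mul₀ (Nat.cast_nonneg _) hG hsum

lemma specNorm_sub_smul_one_le {v : ℝ} (hv : 0 ≤ v) (M : Matrix (Fin d) (Fin d) ℝ) :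
    specNorm (M - v • (1 : Matrix (Fin d) (Fin d) ℝ)) ≤ specNorm M + v := by
  unfold specNorm
  rw [map_sub, map_smul, map_one]
  grw [norm_sub_le, norm_smul, Real.norm_of_nonneg hv]
  gcongr
  exact mul_le_of_le_one_right hv ContinuousLinearMap.norm_id_le

/-- Passing to `(1 - ε) |S|` points costs a factor `1 - α` in the second moments, and the bound on
the second moments also controls the mean. -/
lemma isStableSet_of_sum_inner_sq_le {ε δ v : ℝ} (hε : 0 < ε) (hε' : ε < 1 / 2) (hδ : 1 ≤ δ)
    (hv : 0 ≤ v) (hS : S ≠ 0) (h : ∀ y : Vec d, (S.map fun x ↦ ⟪x - μ, y⟫ ^ 2).sum ≤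
      v * δ ^ 2 * ((1 - ε) * S.card) * ‖y‖ ^ 2) :
    IsStableSet ε δ μ v S := by
  refine ⟨hε, hε', by linarith, fun R hRS hcard ↦ ?_⟩
  have hR : R ≠ 0 := by
    rintro rfl
    have : (0 : ℝ) < (1 - ε) * S.card :=
      mul_pos (by linarith) (by simpa [Multiset.card_pos] using hS)
    simp only [Multiset.card_zero, Nat.cast_zero] at hcard
    linarith
  have hsecond : specNorm (secondMoment μ R) ≤ v * δ ^ 2 :=
    specNorm_secondMoment_le (by positivity) fun y ↦
      calc (R.map fun x ↦ ⟪x - μ, y⟫ ^ 2).sum ≤ (S.map fun x ↦ ⟪x - μ, y⟫ ^ 2).sum :=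
            sum_map_le_sum_map_of_le hRS fun x ↦ sq_nonneg _
        _ ≤ v * δ ^ 2 * R.card * ‖y‖ ^ 2 := (h y).trans (by gcongr)
  constructor
  · rw [← Real.sqrt_sq (zero_le_one.trans hδ), ← Real.sqrt_mul hv]
    exact Real.le_sqrt_of_sq_le ((norm_msMean_sub_sq_le hR μ).trans hsecond)
  · calc specNorm (secondMoment μ R - v • (1 : Matrix (Fin d) (Fin d) ℝ))
        ≤ v * δ ^ 2 + v := (specNorm_sub_smul_one_le hv _).trans (by gcongr)
      _ ≤ v * δ ^ 2 * 2 := by linarith [le_mul_of_one_le_right hv (one_le_pow₀ hδ (n := 2))]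
      _ ≤ v * δ ^ 2 / ε := by
        rw [le_div_iff₀ hε]
        nlinarith [mul_nonneg hv (sq_nonneg δ)]

end Stability

section BucketMeans

variable {d : ℕ}

lemma specNorm_mul_stableRank (M : Matrix (Fin d) (Fin d) ℝ) :
    specNorm M * stableRank M = M.trace := by
  refine mul_div_cancel_of_imp' fun h ↦ ?_
  have hM : M = 0 := by simpa [specNorm] using h
  rw [hM, Matrix.trace_zero]

lemma specNorm_add_trace_div_le {M : Matrix (Fin d) (Fin d) ℝ} (hM : 0 ≤ M.trace) (k : ℕ) :
    specNorm M + M.trace / k ≤ specNorm M * (√(stableRank M / k) + 1) ^ 2 := by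
  have hr : 0 ≤ stableRank M / k := div_nonneg (div_nonneg hM (specNorm_nonneg M)) k.cast_nonneg
  calc specNorm M + M.trace / k = specNorm M * (√(stableRank M / k) ^ 2 + 1) := by
        rw [← specNorm_mul_stableRank M, Real.sq_sqrt hr]
        ring
    _ ≤ specNorm M * (√(stableRank M / k) + 1) ^ 2 := by
        refine mul_le_mul_of_nonneg_left ?_ (specNorm_nonneg M)
        nlinarith [Real.sqrt_nonneg (stableRank M / k)]

lemma cast_le_two_mul_mul_div {n k : ℕ} (hk : 0 < k) (hkn : k ≤ n) :
    (n : ℝ) ≤ 2 * k * (n / k : ℕ) := by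
  have hlt : n < k * (n / k + 1) := Nat.lt_mul_div_succ n hk
  have hle : k * 1 ≤ k * (n / k) := Nat.mul_le_mul_left k (Nat.div_pos hkn hk)
  have : n ≤ 2 * k * (n / k) := by linarith
  exact_mod_cast this

/-- The level above which a projection of a centered mean of one of `k` buckets, each of size `m`,
counts as large: a large multiple of the typical size `√((‖Σ‖ + tr Σ / k) / m)`. -/
noncomputable def projectionThreshold (P : Measure (Vec d)) (k m : ℕ) : ℝ :=
  √(1000000 * (specNorm (covMat P) + (covMat P).trace / k) / m)

variable {n k m : ℕ} {P : Measure (Vec d)}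

lemma projectionThreshold_nonneg : 0 ≤ projectionThreshold P k m := Real.sqrt_nonneg _

section Threshold

variable [IsFiniteMeasure P]

lemma mul_projectionThreshold_sq (hP : MemLp id 2 P) (hm : 0 < m) :
    m * projectionThreshold P k m ^ 2 =
      1000000 * (specNorm (covMat P) + (covMat P).trace / k) := by
  have hs := specNorm_nonneg (covMat P)
  have hr := trace_covMat_nonneg hP
  rw [projectionThreshold, Real.sq_sqrt (by positivity)]
  field_simp

lemma specNorm_eq_zero_of_projectionThreshold_eq_zero (hP : MemLp id 2 P) (hm : 0 < m)
    (h : projectionThreshold P k m = 0) : specNorm (covMat P) = 0 := by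
  have hmul := mul_projectionThreshold_sq (k := k) hP hm
  have hs := specNorm_nonneg (covMat P)
  have hr := div_nonneg (trace_covMat_nonneg hP) k.cast_nonneg
  rw [h] at hmul
  linarith

lemma specNorm_div_mul_projectionThreshold_sq_le (hP : MemLp id 2 P) (hm : 0 < m) :
    specNorm (covMat P) / (m * projectionThreshold P k m ^ 2) ≤ 1 / 1000000 := by
  have hs := specNorm_nonneg (covMat P)
  have hr := div_nonneg (trace_covMat_nonneg hP) k.cast_nonneg
  rw [mul_projectionThreshold_sq hP hm]
  exact div_le_of_le_mul₀ (by positivity) (by norm_num) (by linarith)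

lemma trace_div_mul_projectionThreshold_sq_le (hP : MemLp id 2 P) (hk : 0 < k) (hm : 0 < m) :
    (covMat P).trace / (k / 1000 * (m * projectionThreshold P k m ^ 2)) ≤ 1 / 1000 := by
  have hs := specNorm_nonneg (covMat P)
  have hr := trace_covMat_nonneg hP
  rw [mul_projectionThreshold_sq hP hm]
  refine div_le_of_le_mul₀ (by positivity) (by norm_num) ?_
  have : (covMat P).trace / k * k = (covMat P).trace := by field_simp
  nlinarith

lemma five_mul_projectionThreshold_sq_le (hP : MemLp id 2 P) (hk : 0 < k) (hkn : k ≤ n) :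
    5 * projectionThreshold P k (n / k) ^ 2 ≤ k * specNorm (covMat P) / n *
      (4000 * (√(stableRank (covMat P) / k) + 1)) ^ 2 := by
  have hm : 0 < n / k := Nat.div_pos hkn hk
  have hn : 0 < n := hk.trans_le hkn
  have hmul := mul_projectionThreshold_sq (k := k) hP hm
  have hD := specNorm_add_trace_div_le (trace_covMat_nonneg hP) k
  set q := projectionThreshold P k (n / k)
  calc 5 * q ^ 2 = 5 * (n * q ^ 2) / n := by field_simp
    _ ≤ 5 * (2 * k * (n / k : ℕ) * q ^ 2) / n := by
        gcongr
        exact cast_le_two_mul_mul_div hk hkn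
    _ = k / n * (10000000 * (specNorm (covMat P) + (covMat P).trace / k)) := by
        rw [mul_assoc (2 * (k : ℝ)), hmul]
        ring
    _ ≤ k / n * (16000000 * (specNorm (covMat P) * (√(stableRank (covMat P) / k) + 1) ^ 2)) := by
        have hs := specNorm_nonneg (covMat P)
        gcongr ?_ * ?_
        nlinarith [mul_nonneg hs (sq_nonneg (√(stableRank (covMat P) / k) + 1))]
    _ = k * specNorm (covMat P) / n * (4000 * (√(stableRank (covMat P) / k) + 1)) ^ 2 := by ring

end Threshold

open Classical in
lemma exists_stable_le_bucketMean [IsFiniteMeasure P] (hP : MemLp id 2 P) (hk : 0 < k)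
    (hkn : k ≤ n) {x : Fin n → Vec d} {A B : ℝ} (hA : 0 ≤ A) (hB : 0 ≤ B)
    (hAB : A + B ≤ k / 120) (h : ∀ y, (#{b : Fin k | projectionThreshold P k (n / k) <
      |⟪bucketMean k x b - ∫ x, x ∂P, y⟫|} : ℝ) ≤ A + B * ‖y‖ ^ 2) :
    ∃ S' ≤ toMultiset (bucketMean k x), 0.95 * (k : ℝ) ≤ S'.card ∧
      IsStableSet 0.1 (4000 * (√(stableRank (covMat P) / k) + 1)) (∫ x, x ∂P)
        (k * specNorm (covMat P) / n) S' := by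
  obtain ⟨s, hcard, hs⟩ := exists_finset_sum_inner_sq_le projectionThreshold_nonneg hA hB h
  rw [Fintype.card_fin] at hcard hs
  have hcard' : 0.95 * (k : ℝ) ≤ #s := by linarith
  have hs₀ : s.val.map (bucketMean k x) ≠ 0 := by
    have : (0 : ℝ) < #s := lt_of_lt_of_le (by positivity) hcard'
    simpa [Finset.nonempty_iff_ne_empty] using this
  refine ⟨s.val.map (bucketMean k x), Multiset.map_le_map (Finset.val_le_iff.2 s.subset_univ),
    by simpa using hcard', isStableSet_of_sum_inner_sq_le (by norm_num) (by norm_num) ?_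
      (div_nonneg (mul_nonneg k.cast_nonneg (specNorm_nonneg _)) n.cast_nonneg) hs₀ fun y ↦ ?_⟩
  · linarith [Real.sqrt_nonneg (stableRank (covMat P) / k)]
  have hthreshold := five_mul_projectionThreshold_sq_le hP hk hkn
  rw [Multiset.map_map, Multiset.card_map, Finset.card_val]
  refine (hs y).trans ?_
  gcongr ?_ * _
  nlinarith [sq_nonneg (projectionThreshold P k (n / k))]

/-- The constants leave room for the factor `6` lost in the selection: the count bound `A + B ‖y‖²`
below satisfies `6 (A + B) ≤ 0.05 k`. -/
lemma measure_not_exists_stable_le [IsProbabilityMeasure P] (hP : MemLp id 2 P) (hk : 0 < k)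
    (hkn : k ≤ n) :
    (Measure.pi fun _ : Fin n ↦ P) {x | ¬ ∃ S' ≤ toMultiset (bucketMean k x),
      0.95 * (k : ℝ) ≤ S'.card ∧
      IsStableSet 0.1 (4000 * (√(stableRank (covMat P) / k) + 1)) (∫ x, x ∂P)
        (k * specNorm (covMat P) / n) S'} ≤ ENNReal.ofReal (Real.exp (-(k / 1000))) := by
  have hm : 0 < n / k := Nat.div_pos hkn hk
  have hs := specNorm_nonneg (covMat P)
  have hr := trace_covMat_nonneg hP
  refine (measure_mono (Set.compl_subset_compl.2 fun x hall ↦ ?_)).trans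
    (measure_card_large_bucketMean_le (q := projectionThreshold P k (n / k)) (β := k / 1000) hP hm
      projectionThreshold_nonneg (by positivity)
      (specNorm_eq_zero_of_projectionThreshold_eq_zero hP hm) (k / 1000))
  refine exists_stable_le_bucketMean hP hk hkn (by positivity) (by positivity) ?_ hall
  have hB := specNorm_div_mul_projectionThreshold_sq_le (k := k) hP hm
  have hA := trace_div_mul_projectionThreshold_sq_le hP hk hm
  have hk' : (0 : ℝ) ≤ 4 * k := by positivity
  linarith [mul_le_mul_of_nonneg_left hB hk', mul_le_mul_of_nonneg_left hA hk']

end BucketMeans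

lemma bucket_count_bounds {n k : ℕ} {ε ε' τ : ℝ} (hε : 0 ≤ ε) (hτ : 0 < τ) (hτ' : τ < 1)
    (hK : 2000 * (ε + Real.log (1 / τ) / n) ≤ ε') (hε' : ε' ≤ 1) (hk : k = ⌊ε' * n⌋₊)
    (hk₁ : 1 ≤ k) :
    k ≤ n ∧ ε * n ≤ 0.01 * k ∧ Real.exp (-(k / 1000)) ≤ τ := by
  have hkn : k ≤ n := hk ▸ Nat.floor_le_of_le (mul_le_of_le_one_left n.cast_nonneg hε')
  have hn : (0 : ℝ) < n := by exact_mod_cast hk₁.trans hkn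
  have hk₁' : (1 : ℝ) ≤ k := by exact_mod_cast hk₁
  have hfloor : ε' * n < k + 1 := hk ▸ Nat.lt_floor_add_one _
  have hlog : 0 ≤ Real.log (1 / τ) := Real.log_nonneg (one_le_one_div hτ hτ'.le)
  have hsum : 2000 * (ε * n + Real.log (1 / τ)) ≤ 2 * k :=
    calc 2000 * (ε * n + Real.log (1 / τ)) = 2000 * (ε + Real.log (1 / τ) / n) * n := by field_simp
      _ ≤ ε' * n := by gcongr
      _ ≤ 2 * k := by linarith
  refine ⟨hkn, by linarith, ?_⟩
  rw [← Real.le_log_iff_exp_le hτ]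
  rw [one_div, Real.log_inv] at hsum
  linarith [mul_nonneg hε hn.le]

end MoMStability

/-- `K` and `C` are absolute constants. `X` is the i.i.d. sample from `P`; `T` lists, in an
arbitrary order, the points of the corrupted sample, and both the points and the order may depend
on `X` and on further randomness; `π` is the shuffle used for random bucketing. The last line
bounds the outer probability of the failure event, so no measurability of that event is
presupposed. -/
theorem theorem1p6 :
    ∃ K C : ℝ, 0 < K ∧ 0 < C ∧
      ∀ (d n : ℕ) (Ω : Type*) [MeasurableSpace Ω] (Pr : Measure Ω) [IsProbabilityMeasure Pr]
        (P : Measure (Vec d)) [IsProbabilityMeasure P]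
        (X : Fin n → Ω → Vec d) (T : Ω → Fin n → Vec d) (π : Ω → Equiv.Perm (Fin n))
        (ε ε' τ : ℝ) (k : ℕ),
        MemLp id 2 P →
        (∀ i, Measurable (X i)) → (∀ i, HasLaw (X i) P Pr) → iIndepFun X Pr →
        0 ≤ ε → 0 < τ → τ < 1 →
        Measurable T →
        (∀ᵐ ω ∂Pr, IsCorruption ε (toMultiset fun i => X i ω) (toMultiset (T ω))) →
        Measurable π → HasLaw π (uniformOn Set.univ) Pr →
        IndepFun π (fun ω => ((fun i => X i ω), T ω)) Pr →
        K * (ε + Real.log (1 / τ) / n) ≤ ε' → ε' ≤ 1 →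
        k = ⌊ε' * n⌋₊ → 1 ≤ k →
        Pr {ω | ¬ ∃ S S' : Multiset (Vec d),
            IsCorruption 0.01 S (momPreprocess k (T ω) (π ω)) ∧
            S' ≤ S ∧ 0.95 * (k : ℝ) ≤ (S'.card : ℝ) ∧
            IsStableSet 0.1 (C * (Real.sqrt (stableRank (covMat P) / k) + 1))
              (∫ x, x ∂P) (k * specNorm (covMat P) / n) S'} ≤ ENNReal.ofReal τ := by
  refine ⟨2000, 4000, by norm_num, by norm_num, fun d n Ω _ Pr _ P _ X T π ε ε' τ k hP hX hlaw hind
    hε hτ hτ' hT hcor hπ hunif hπV hK hε' hk hk₁ ↦ ?_⟩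
  obtain ⟨hkn, hεk, hexp⟩ := bucket_count_bounds hε hτ hτ' hK hε' hk hk₁
  let good (S : Multiset (Vec d)) : Prop := ∃ S' ≤ S, 0.95 * (k : ℝ) ≤ S'.card ∧
    IsStableSet 0.1 (4000 * (√(stableRank (covMat P) / k) + 1)) (∫ x, x ∂P)
      (k * specNorm (covMat P) / n) S'
  calc _ ≤ Pr {ω | ¬ ∃ S, IsCorruption 0.01 S (momPreprocess k (T ω) (π ω)) ∧ good S} :=
        measure_mono <| Set.compl_subset_compl.2 <| by
          rintro ω ⟨S, hS, S', hS'⟩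
          exact ⟨S, S', hS, hS'⟩
    _ ≤ Measure.pi (fun _ ↦ P) {x : Fin n → Vec d | ¬ good (toMultiset (bucketMean k x))} :=
        measure_corrupted_le hX hlaw hind hT hcor hπ hunif hπV hεk good
    _ ≤ ENNReal.ofReal (Real.exp (-(k / 1000))) := measure_not_exists_stable_le hP hk₁ hkn
    _ ≤ ENNReal.ofReal τ := ENNReal.ofReal_le_ofReal hexp
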